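/- Let $f\in\mathbb{R}$ and let $\varphi:\mathbb{R}\to\mathbb{R}$ be twice continuously differentiable with period $1$. Put $$w_0(x)=\int_0^1 e^{\varphi(x+s)-\varphi(x)-fs}\,ds,\qquad M_0=\int_0^1 w_0(x)\,dx,\qquad u_0(x)=\frac{w_0(x)}{M_0},\qquad J_0=\frac{1-e^{-f}}{M_0}.$$ Then $M_0>0$ and the following hold. 1. $u_0$ is the unique normalized periodic steady state of the Fokker–Planck equation $$\frac{\partial\rho}{\partial t}=\frac{\partial}{\partial x}\Big((\varphi'-f)\rho+\frac{\partial\rho}{\partial x}\Big);\tag{1}$$ that is, $u_0$ is the only time-independent classical solution $u$ of (1) with $u(x+1)=u(x)$ for all $x$ and $\int_0^1u(x)\,dx=1$. 2. The flux of $u_0$ is constant: $-\big((\varphi'(x)-f)u_0(x)+u_0'(x)\big)=J_0$ for every $x\in\mathbb{R}$. 3. Let $\rho(x,t)$ be any classical solution of (1) on $\mathbb{R}\times(0,\infty)$ (meaning that $\rho,\ \partial_x\rho,\ \partial_x^2\rho,\ \partial_t\rho$ exist and are continuous there) such that $\rho(\cdot,t)$ is a probability density on $\mathbb{R}$ for every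 $t>0$. Then the series $\rho_0(x,t)=\sum_{j\in\mathbb{Z}}\rho(j+x,t)$ converges for all $x\in\mathbb{R}$ and $t>0$, and $\rho_0(x,t)\to u_0(x)$ as $t\to\infty$, uniformly in $x\in\mathbb{R}$. -/

import Mathlib

open Filter Topology MeasureTheory Set

noncomputable section

/-- `FokkerPlanck φ f ρ`: the function `ρ (x, t)`, written `ρ x t`, is a classical (`C²` in `x`,
`C¹` in `t`) solution on `ℝ × (0, ∞)` of `∂ρ/∂t = ∂/∂x ((φ' - f) ρ + ∂ρ/∂x)`. -/
structure FokkerPlanck (φ : ℝ → ℝ) (f : ℝ) (ρ : ℝ → ℝ → ℝ) : Prop where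
  contDiff_space : ∀ t > 0, ContDiff ℝ 2 (fun x => ρ x t)
  differentiableAt_time : ∀ x, ∀ t > 0, DifferentiableAt ℝ (fun s => ρ x s) t
  continuousOn : ContinuousOn (fun p : ℝ × ℝ => ρ p.1 p.2) (univ ×ˢ Ioi 0)
  continuousOn_dx : ContinuousOn (fun p : ℝ × ℝ => deriv (fun x => ρ x p.2) p.1) (univ ×ˢ Ioi 0)
  continuousOn_dxx :
    ContinuousOn (fun p : ℝ × ℝ => iteratedDeriv 2 (fun x => ρ x p.2) p.1) (univ ×ˢ Ioi 0)
  continuousOn_dt : ContinuousOn (fun p : ℝ × ℝ => deriv (fun s => ρ p.1 s) p.2) (univ ×ˢ Ioi 0)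
  equation : ∀ x, ∀ t > 0,
    HasDerivAt (fun y => (deriv φ y - f) * ρ y t + deriv (fun z => ρ z t) y)
      (deriv (fun s => ρ x s) t) x

/-- A solution of the Fokker–Planck equation that is a probability density on `ℝ` at each time
`t > 0`. Nothing is asked of the initial law. -/
structure FokkerPlanckDensity (φ : ℝ → ℝ) (f : ℝ) (ρ : ℝ → ℝ → ℝ) : Prop where
  solution : FokkerPlanck φ f ρ
  nonneg : ∀ x, ∀ t > 0, 0 ≤ ρ x t
  integral_eq_one : ∀ t > 0, ∫ x, ρ x t = 1

/-- The periodized density `ρ₀(x, t) = ∑_{j ∈ ℤ} ρ(j + x, t)`. -/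
def periodized (ρ : ℝ → ℝ → ℝ) (x t : ℝ) : ℝ := ∑' j : ℤ, ρ ((j : ℝ) + x) t

/-- A normalized periodic steady state: a time-independent solution of the Fokker–Planck
equation with period `1` and integral `1` over a period. -/
structure SteadyState (φ : ℝ → ℝ) (f : ℝ) (u : ℝ → ℝ) : Prop where
  solution : FokkerPlanck φ f (fun x _ => u x)
  periodic : Function.Periodic u 1
  integral_eq_one : ∫ x in (0 : ℝ)..1, u x = 1

/-- The probability flux `-((φ' - f) u + u')`. -/
def flux (φ : ℝ → ℝ) (f : ℝ) (u : ℝ → ℝ) (x : ℝ) : ℝ :=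
  -((deriv φ x - f) * u x + deriv u x)

def w₀ (φ : ℝ → ℝ) (f : ℝ) (x : ℝ) : ℝ :=
  ∫ s in (0 : ℝ)..1, Real.exp (φ (x + s) - φ x - f * s)

def M₀ (φ : ℝ → ℝ) (f : ℝ) : ℝ := ∫ x in (0 : ℝ)..1, w₀ φ f x

def u₀ (φ : ℝ → ℝ) (f : ℝ) (x : ℝ) : ℝ := w₀ φ f x / M₀ φ f

end

/-!
With the tilted potential `Φ x = φ x - f x` one has `w₀ = exp (-Φ) ∫_x^{x+1} exp Φ`, whose flux is
constant. Two normalized periodic steady states differ by a function `d` with mean zero and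
constant flux, that is, `(exp Φ * d)' = c exp Φ`; since `d` has a zero `x`, and hence also the zero
`x + 1`, both `c` and `d` vanish (`eq_zero_of_const_flux`).

The convergence of the periodized density `R` needs no assumption on the decay of `ρ` at infinity.
It rests on a mean value inequality: a nonnegative function with `∂_t w ≤ ∂_x² w + κ w` is bounded
at a point by its integral over the parabolic cylinder below it (`le_integral_of_subsolution`). It
is proved by testing with an explicit cut-off heat kernel. Multiplication by `exp (Φ / 2)` turns the
Fokker–Planck equation into a heat equation with a bounded potential, so that the inequality applies
to nonnegative solutions (`IsSolution.le_integral`) and to squares of arbitrary solutions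
(`IsSolution.sq_le_integral`). For the translates of `ρ` it gives a Weierstrass majorant
(`exists_summable_bound`): the masses of the cylinders above the windows `[j - 2, j + 3]` are
summable.

Thus `R` is continuous, periodic and of mean one. Its spatial derivatives are not controlled
directly, but those of its time integrals are, since the space derivative of the time integral of
the flux of `ρ` is an increment of `ρ` (`exists_flux_periodized`). For a time average `V` of `R` and
`V - u₀ = u₀ H`, the energy `∫ u₀ H²` over a period has derivative `-2 ∫ u₀ H'²`
(`energy_slice_le`), and as `H` has a zero, a one-dimensional Poincaré inequality yields exponential
decay. The constants do not depend on the length of the averaging interval, so the decay passes to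
`R` itself (`PeriodicTimeIntegralSolution.exists_integral_sq_le`). The mean value inequality for
squares turns it into uniform decay (`exists_sq_periodized_sub_le`).
-/

/-! ### Integrals over rectangles -/

/-- A function continuous on a rectangle extends continuously to the plane: precompose with the
projections onto the sides. -/
lemma exists_continuous_extension_rect {F : ℝ → ℝ → ℝ} {a b c d : ℝ} (hab : a ≤ b) (hcd : c ≤ d)
    (hF : ContinuousOn (Function.uncurry F) (Icc a b ×ˢ Icc c d)) :
    ∃ G : ℝ → ℝ → ℝ, Continuous (Function.uncurry G) ∧
      ∀ x ∈ Icc a b, ∀ y ∈ Icc c d, G x y = F x y := by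
  refine ⟨fun x y => F (projIcc a b hab x) (projIcc c d hcd y), ?_, ?_⟩
  · refine hF.comp_continuous (f := fun p : ℝ × ℝ =>
      ((projIcc a b hab p.1 : ℝ), (projIcc c d hcd p.2 : ℝ))) ?_ ?_
    · exact (continuous_subtype_val.comp (continuous_projIcc.comp continuous_fst)).prodMk
        (continuous_subtype_val.comp (continuous_projIcc.comp continuous_snd))
    · intro p
      exact ⟨(projIcc a b hab p.1).2, (projIcc c d hcd p.2).2⟩
  · intro x hx y hy
    simp only [projIcc_of_mem hab hx, projIcc_of_mem hcd hy]

lemma integral_swap_rect {F : ℝ → ℝ → ℝ} {a b c d : ℝ} (hab : a ≤ b) (hcd : c ≤ d)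
    (hF : ContinuousOn (Function.uncurry F) (Icc a b ×ˢ Icc c d)) :
    ∫ x in a..b, ∫ y in c..d, F x y = ∫ y in c..d, ∫ x in a..b, F x y := by
  rw [intervalIntegral.integral_of_le hab, intervalIntegral.integral_of_le hcd]
  simp_rw [intervalIntegral.integral_of_le hab, intervalIntegral.integral_of_le hcd]
  apply integral_integral_swap
  rw [Measure.prod_restrict]
  exact (hF.integrableOn_compact (isCompact_Icc.prod isCompact_Icc)).mono_set
    (prod_mono Ioc_subset_Icc_self Ioc_subset_Icc_self)

lemma continuousOn_integral_rect {F : ℝ → ℝ → ℝ} {a b c d : ℝ} (hab : a ≤ b) (hcd : c ≤ d)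
    (hF : ContinuousOn (Function.uncurry F) (Icc a b ×ˢ Icc c d)) :
    ContinuousOn (fun y => ∫ x in a..b, F x y) (Icc c d) := by
  obtain ⟨G, hG, hGF⟩ := exists_continuous_extension_rect hab hcd hF
  have h : Continuous fun y => ∫ x in a..b, G x y :=
    intervalIntegral.continuous_parametric_intervalIntegral_of_continuous'
      (f := fun y x => G x y) (hG.comp continuous_swap) a b
  refine h.continuousOn.congr fun y hy => ?_
  refine intervalIntegral.integral_congr fun x hx => ?_
  rw [uIcc_of_le hab] at hx
  exact (hGF x hx y hy).symm

lemma ContinuousOn.rect_left {F : ℝ → ℝ → ℝ} {s t : Set ℝ}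
    (hF : ContinuousOn (Function.uncurry F) (s ×ˢ t)) {y : ℝ} (hy : y ∈ t) :
    ContinuousOn (fun x => F x y) s :=
  hF.comp (f := fun x => (x, y)) (by fun_prop) fun _ hx => ⟨hx, hy⟩

lemma ContinuousOn.rect_right {F : ℝ → ℝ → ℝ} {s t : Set ℝ}
    (hF : ContinuousOn (Function.uncurry F) (s ×ˢ t)) {x : ℝ} (hx : x ∈ s) :
    ContinuousOn (fun y => F x y) t :=
  hF.comp (f := fun y => (x, y)) (by fun_prop) fun _ hy => ⟨hx, hy⟩

lemma ContinuousOn.intervalIntegrable_Icc {g : ℝ → ℝ} {a b : ℝ} (hab : a ≤ b)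
    (hg : ContinuousOn g (Icc a b)) : IntervalIntegrable g volume a b :=
  ContinuousOn.intervalIntegrable (by rwa [uIcc_of_le hab])

/-- A continuous function with mean zero has a zero. -/
lemma exists_eq_zero_of_integral_eq_zero {g : ℝ → ℝ} (hg : ContinuousOn g (Icc 0 1))
    (h0 : ∫ x in (0 : ℝ)..1, g x = 0) : ∃ x ∈ Icc (0 : ℝ) 1, g x = 0 := by
  by_contra! hne
  have hint := hg.intervalIntegrable_Icc zero_le_one
  have hconn : IsPreconnected (Icc (0 : ℝ) 1) := isPreconnected_Icc
  have hsign : (∀ x ∈ Icc (0 : ℝ) 1, 0 < g x) ∨ ∀ x ∈ Icc (0 : ℝ) 1, g x < 0 := by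
    by_contra! hcon
    obtain ⟨⟨x, hx, hgx⟩, y, hy, hgy⟩ := hcon
    obtain ⟨z, hz, hgz⟩ := hconn.intermediate_value hx hy hg ⟨hgx, hgy⟩
    exact hne z hz hgz
  rcases hsign with h | h
  · have := intervalIntegral.intervalIntegral_pos_of_pos_on hint
      (fun x hx => h x ⟨hx.1.le, hx.2.le⟩) zero_lt_one
    linarith
  · have := intervalIntegral.intervalIntegral_pos_of_pos_on hint.neg
      (fun x hx => by simpa using h x ⟨hx.1.le, hx.2.le⟩) zero_lt_one
    simp only [Pi.neg_apply, intervalIntegral.integral_neg] at this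
    linarith

/-! ### The stationary density -/

/-- The tilted potential `x ↦ φ x - f x`, a primitive of the drift coefficient `φ' - f`. -/
def tilted (φ : ℝ → ℝ) (f x : ℝ) : ℝ := φ x - f * x

section Stationary

variable {φ : ℝ → ℝ} {f : ℝ}

lemma contDiff_tilted (hφ : ContDiff ℝ 2 φ) : ContDiff ℝ 2 (tilted φ f) := by
  unfold tilted; fun_prop

lemma hasDerivAt_potential (hφ : ContDiff ℝ 2 φ) (x : ℝ) : HasDerivAt φ (deriv φ x) x :=
  (hφ.differentiable (by norm_num)).differentiableAt.hasDerivAt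

lemma contDiff_deriv_potential (hφ : ContDiff ℝ 2 φ) : ContDiff ℝ 1 (deriv φ) :=
  (contDiff_succ_iff_deriv (n := 1)).1 hφ |>.2.2

lemma hasDerivAt_deriv_potential (hφ : ContDiff ℝ 2 φ) (x : ℝ) :
    HasDerivAt (deriv φ) (deriv (deriv φ) x) x :=
  ((contDiff_deriv_potential hφ).differentiable (by norm_num)).differentiableAt.hasDerivAt

lemma continuous_deriv_potential (hφ : ContDiff ℝ 2 φ) : Continuous (deriv φ) :=
  (contDiff_deriv_potential hφ).continuous

lemma continuous_deriv_deriv_potential (hφ : ContDiff ℝ 2 φ) : Continuous (deriv (deriv φ)) :=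
  (contDiff_deriv_potential hφ).continuous_deriv le_rfl

lemma hasDerivAt_tilted (hφ : ContDiff ℝ 2 φ) (x : ℝ) :
    HasDerivAt (tilted φ f) (deriv φ x - f) x := by
  exact ((hasDerivAt_potential hφ x).sub ((hasDerivAt_id x).const_mul f)).congr_deriv (by simp)

lemma periodic_deriv {g : ℝ → ℝ} (hg : Function.Periodic g 1) : Function.Periodic (deriv g) 1 := by
  intro x
  have : (fun y => g (y + 1)) = g := funext hg
  rw [← deriv_comp_add_const, this]

lemma tilted_add_one (hper : Function.Periodic φ 1) (x : ℝ) :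
    tilted φ f (x + 1) = tilted φ f x - f := by
  simp only [tilted, hper x]; ring

lemma w₀_eq (φ : ℝ → ℝ) (f x : ℝ) :
    w₀ φ f x = Real.exp (-tilted φ f x) * ∫ y in x..x + 1, Real.exp (tilted φ f y) := by
  have := intervalIntegral.integral_comp_add_left (a := 0) (b := 1)
    (fun y => Real.exp (tilted φ f y)) x
  rw [add_zero] at this
  rw [← this, ← intervalIntegral.integral_const_mul, w₀]
  refine intervalIntegral.integral_congr fun s _ => ?_
  simp only [tilted, ← Real.exp_add]
  congr 1; ring

lemma continuous_exp_tilted (hφ : ContDiff ℝ 2 φ) :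
    Continuous fun y => Real.exp (tilted φ f y) :=
  Real.continuous_exp.comp (contDiff_tilted hφ).continuous

lemma w₀_pos (hφ : ContDiff ℝ 2 φ) (x : ℝ) : 0 < w₀ φ f x := by
  rw [w₀_eq]
  exact mul_pos (Real.exp_pos _) (intervalIntegral.intervalIntegral_pos_of_pos
    ((continuous_exp_tilted hφ).intervalIntegrable _ _) (fun _ => Real.exp_pos _) (by linarith))

lemma hasDerivAt_w₀ (hφ : ContDiff ℝ 2 φ) (hper : Function.Periodic φ 1) (x : ℝ) :
    HasDerivAt (w₀ φ f) (Real.exp (-f) - 1 - (deriv φ x - f) * w₀ φ f x) x := by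
  have hc := continuous_exp_tilted (f := f) hφ
  have hint : HasDerivAt (fun x => ∫ y in x..x + 1, Real.exp (tilted φ f y))
      (Real.exp (tilted φ f (x + 1)) - Real.exp (tilted φ f x)) x := by
    have h (z : ℝ) := intervalIntegral.integral_hasDerivAt_right (a := 0)
      (hc.intervalIntegrable 0 z) (hc.stronglyMeasurableAtFilter _ _) hc.continuousAt
    have := (h (x + 1)).comp_add_const x 1 |>.sub (h x)
    refine this.congr_of_eventuallyEq (Eventually.of_forall fun z => ?_)
    exact (intervalIntegral.integral_interval_sub_left (hc.intervalIntegrable _ _)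
      (hc.intervalIntegrable _ _)).symm
  have h := ((hasDerivAt_tilted (f := f) hφ x).neg.exp).mul hint
  rw [show w₀ φ f = fun x => Real.exp (-tilted φ f x) * ∫ y in x..x + 1, Real.exp (tilted φ f y)
    from funext (w₀_eq φ f)]
  refine h.congr_deriv ?_
  have h1 : Real.exp (-tilted φ f x) * Real.exp (tilted φ f (x + 1)) = Real.exp (-f) := by
    rw [← Real.exp_add, tilted_add_one hper]; congr 1; ring
  have h2 : Real.exp (-tilted φ f x) * Real.exp (tilted φ f x) = 1 := by
    rw [← Real.exp_add]; simp
  simp only [Pi.neg_apply, mul_sub, h1, h2]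
  ring

lemma contDiff_w₀ (hφ : ContDiff ℝ 2 φ) (hper : Function.Periodic φ 1) :
    ContDiff ℝ 2 (w₀ φ f) := by
  have hd : deriv (w₀ φ f) = fun x => Real.exp (-f) - 1 - (deriv φ x - f) * w₀ φ f x :=
    funext fun x => (hasDerivAt_w₀ hφ hper x).deriv
  have hdiff : Differentiable ℝ (w₀ φ f) := fun x => (hasDerivAt_w₀ hφ hper x).differentiableAt
  have hφ1 := contDiff_deriv_potential hφ
  have h1 : ContDiff ℝ 1 (w₀ φ f) := by
    rw [contDiff_one_iff_deriv]
    refine ⟨hdiff, ?_⟩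
    rw [hd]
    have := hdiff.continuous
    have := hφ1.continuous
    fun_prop
  refine (contDiff_succ_iff_deriv (n := 1)).2 ⟨hdiff, by simp, ?_⟩
  rw [hd]
  fun_prop

lemma periodic_w₀ (hper : Function.Periodic φ 1) : Function.Periodic (w₀ φ f) 1 := by
  intro x
  simp only [w₀]
  refine intervalIntegral.integral_congr fun s _ => ?_
  have : φ (x + 1 + s) = φ (x + s) := by rw [← hper (x + s)]; congr 1; ring
  simp only [this, hper x]

lemma M₀_pos (hφ : ContDiff ℝ 2 φ) (hper : Function.Periodic φ 1) : 0 < M₀ φ f :=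
  intervalIntegral.intervalIntegral_pos_of_pos
    ((contDiff_w₀ hφ hper).continuous.intervalIntegrable _ _) (w₀_pos hφ) zero_lt_one

lemma u₀_pos (hφ : ContDiff ℝ 2 φ) (hper : Function.Periodic φ 1) (x : ℝ) : 0 < u₀ φ f x :=
  div_pos (w₀_pos hφ x) (M₀_pos hφ hper)

lemma contDiff_u₀ (hφ : ContDiff ℝ 2 φ) (hper : Function.Periodic φ 1) : ContDiff ℝ 2 (u₀ φ f) :=
  (contDiff_w₀ hφ hper).div_const _

lemma periodic_u₀ (hper : Function.Periodic φ 1) : Function.Periodic (u₀ φ f) 1 := fun x => by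
  simp only [u₀, periodic_w₀ hper x]

lemma hasDerivAt_u₀ (hφ : ContDiff ℝ 2 φ) (hper : Function.Periodic φ 1) (x : ℝ) :
    HasDerivAt (u₀ φ f) (-((1 - Real.exp (-f)) / M₀ φ f) - (deriv φ x - f) * u₀ φ f x) x := by
  refine ((hasDerivAt_w₀ hφ hper x).div_const (M₀ φ f)).congr_deriv ?_
  simp only [u₀]; ring

lemma integral_u₀ (hφ : ContDiff ℝ 2 φ) (hper : Function.Periodic φ 1) :
    ∫ x in (0 : ℝ)..1, u₀ φ f x = 1 := by
  simp only [u₀, intervalIntegral.integral_div]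
  exact div_self (M₀_pos hφ hper).ne'

lemma flux_u₀ (hφ : ContDiff ℝ 2 φ) (hper : Function.Periodic φ 1) (x : ℝ) :
    flux φ f (u₀ φ f) x = (1 - Real.exp (-f)) / M₀ φ f := by
  rw [flux, (hasDerivAt_u₀ hφ hper x).deriv]; ring

lemma FokkerPlanck.of_stationary {u : ℝ → ℝ} (hu : ContDiff ℝ 2 u)
    (heq : ∀ x, HasDerivAt (fun y => (deriv φ y - f) * u y + deriv u y) 0 x) :
    FokkerPlanck φ f (fun x _ => u x) where
  contDiff_space _ _ := hu
  differentiableAt_time _ _ _ := differentiableAt_const _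
  continuousOn := (hu.continuous.comp continuous_fst).continuousOn
  continuousOn_dx := ((hu.continuous_deriv (by norm_num)).comp continuous_fst).continuousOn
  continuousOn_dxx := ((hu.continuous_iteratedDeriv 2 le_rfl).comp continuous_fst).continuousOn
  continuousOn_dt := by simpa using continuousOn_const
  equation x _ _ := by simpa using heq x

lemma fokkerPlanck_u₀ (hφ : ContDiff ℝ 2 φ) (hper : Function.Periodic φ 1) :
    FokkerPlanck φ f (fun x _ => u₀ φ f x) := by
  refine .of_stationary (contDiff_u₀ hφ hper) fun x => ?_
  have : (fun y => (deriv φ y - f) * u₀ φ f y + deriv (u₀ φ f) y) =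
      fun _ => -((1 - Real.exp (-f)) / M₀ φ f) :=
    funext fun y => by rw [(hasDerivAt_u₀ hφ hper y).deriv]; ring
  rw [this]
  exact hasDerivAt_const _ _

lemma steadyState_u₀ (hφ : ContDiff ℝ 2 φ) (hper : Function.Periodic φ 1) :
    SteadyState φ f (u₀ φ f) :=
  ⟨fokkerPlanck_u₀ hφ hper, periodic_u₀ hper, integral_u₀ hφ hper⟩

/-- A function with constant flux, written as a first order linear equation with integrating
factor `exp (tilted φ f)`, vanishes if it is periodic and has mean zero: it vanishes at
some `x` and at `x + 1`, so that the constant is zero. -/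
lemma eq_zero_of_const_flux (hφ : ContDiff ℝ 2 φ) {d : ℝ → ℝ} {c : ℝ}
    (hd : ∀ x, HasDerivAt d (c - (deriv φ x - f) * d x) x) (hdper : Function.Periodic d 1)
    (h0 : ∫ x in (0 : ℝ)..1, d x = 0) : d = 0 := by
  have hcont : Continuous d := continuous_iff_continuousAt.2 fun x => (hd x).continuousAt
  have hexp := continuous_exp_tilted (f := f) hφ
  have hder (c' : ℝ) (hc' : c' = c) (x : ℝ) : HasDerivAt (fun y => Real.exp (tilted φ f y) * d y)
      (c' * Real.exp (tilted φ f x)) x := by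
    refine ((hasDerivAt_tilted (f := f) hφ x).exp.mul (hd x)).congr_deriv ?_
    rw [hc']; ring
  obtain ⟨x₁, -, hx₁⟩ := exists_eq_zero_of_integral_eq_zero hcont.continuousOn h0
  have hc : c = 0 := by
    have h := intervalIntegral.integral_eq_sub_of_hasDerivAt (a := x₁) (b := x₁ + 1)
      (fun x _ => hder c rfl x) ((hexp.const_mul c).intervalIntegrable _ _)
    rw [hdper x₁, hx₁, mul_zero, mul_zero, sub_zero, intervalIntegral.integral_const_mul] at h
    have hpos : 0 < ∫ x in x₁..x₁ + 1, Real.exp (tilted φ f x) :=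
      intervalIntegral.intervalIntegral_pos_of_pos (hexp.intervalIntegrable _ _)
        (fun _ => Real.exp_pos _) (by linarith)
    exact (mul_eq_zero.1 h).resolve_right hpos.ne'
  have hconst := is_const_of_deriv_eq_zero (fun x => (hder 0 hc.symm x).differentiableAt)
    (fun x => by rw [(hder 0 hc.symm x).deriv, zero_mul])
  funext x
  have := hconst x x₁
  rw [hx₁, mul_zero] at this
  exact (mul_eq_zero.1 this).resolve_left (Real.exp_pos _).ne'

lemma SteadyState.eq_u₀ (hφ : ContDiff ℝ 2 φ) (hper : Function.Periodic φ 1) {u : ℝ → ℝ}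
    (hu : SteadyState φ f u) : u = u₀ φ f := by
  have hu2 : ContDiff ℝ 2 u := hu.solution.contDiff_space 1 one_pos
  have hF : ∀ x, HasDerivAt (fun y => (deriv φ y - f) * u y + deriv u y) 0 x := fun x => by
    simpa using hu.solution.equation x 1 one_pos
  have hconst := is_const_of_deriv_eq_zero (fun x => (hF x).differentiableAt)
    (fun x => (hF x).deriv)
  have hud : ∀ x, HasDerivAt u (deriv u x) x := fun x =>
    (hu2.differentiable (by norm_num)).differentiableAt.hasDerivAt
  have hzero := eq_zero_of_const_flux (f := f) hφ
    (d := fun x => u x - u₀ φ f x)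
    (c := (deriv φ 0 - f) * u 0 + deriv u 0 + (1 - Real.exp (-f)) / M₀ φ f)
    (fun x => ((hud x).sub (hasDerivAt_u₀ hφ hper x)).congr_deriv (by
      rw [hconst 0 x]; ring))
    (fun x => by simp only [hu.periodic x, periodic_u₀ hper x])
    (by
      rw [intervalIntegral.integral_sub (hu2.continuous.intervalIntegrable _ _)
        ((contDiff_u₀ hφ hper).continuous.intervalIntegrable _ _), hu.integral_eq_one,
        integral_u₀ hφ hper, sub_self])
  funext x
  exact sub_eq_zero.1 (congrFun hzero x)

end Stationary

/-! ### A mean value inequality for subsolutions of the heat equation -/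

/-- The heat kernel up to a constant: `p ^ (-1/2) * exp (-z² / (4p))`. -/
noncomputable def heat (z p : ℝ) : ℝ := (√p)⁻¹ * Real.exp (-(z ^ 2 / (4 * p)))

lemma heat_pos (z : ℝ) {p : ℝ} (hp : 0 < p) : 0 < heat z p :=
  mul_pos (inv_pos.2 (Real.sqrt_pos.2 hp)) (Real.exp_pos _)

lemma hasDerivAt_heat_left (z p : ℝ) :
    HasDerivAt (fun z => heat z p) (-(z / (2 * p)) * heat z p) z := by
  have h : HasDerivAt (fun z : ℝ => -(z ^ 2 / (4 * p))) (-(2 * z / (4 * p))) z := by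
    refine (((hasDerivAt_pow 2 z).div_const (4 * p)).neg).congr_deriv ?_
    simp
  refine (h.exp.const_mul (√p)⁻¹).congr_deriv ?_
  rw [heat]; ring

lemma hasDerivAt_heat_right (z : ℝ) {p : ℝ} (hp : 0 < p) :
    HasDerivAt (fun p => heat z p) ((z ^ 2 / (4 * p ^ 2) - 1 / (2 * p)) * heat z p) p := by
  have hs : 0 < √p := Real.sqrt_pos.2 hp
  have h1 := (Real.hasDerivAt_sqrt hp.ne').inv hs.ne'
  have h2 : HasDerivAt (fun p : ℝ => -(z ^ 2 / (4 * p))) (z ^ 2 / (4 * p ^ 2)) p := by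
    have h := ((hasDerivAt_const p (z ^ 2)).div ((hasDerivAt_id p).const_mul 4)
      (by simpa using hp.ne')).neg
    refine h.congr_deriv ?_
    simp only [id]
    field_simp
    ring
  refine (h1.mul h2.exp).congr_deriv ?_
  rw [heat, Real.sq_sqrt hp.le]
  simp only [Pi.inv_apply]
  field_simp
  ring

lemma continuousOn_heat : ContinuousOn (fun q : ℝ × ℝ => heat q.1 q.2) (univ ×ˢ Ioi 0) := by
  unfold heat
  have h1 : ∀ q ∈ (univ : Set ℝ) ×ˢ Ioi (0 : ℝ), √q.2 ≠ 0 := fun q hq =>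
    (Real.sqrt_pos.2 hq.2).ne'
  have h2 : ∀ q ∈ (univ : Set ℝ) ×ˢ Ioi (0 : ℝ), 4 * q.2 ≠ 0 := fun q hq =>
    mul_ne_zero four_ne_zero (ne_of_gt hq.2)
  exact ((continuous_snd.sqrt.continuousOn).inv₀ h1).mul
    (Real.continuous_exp.comp_continuousOn
      (((continuous_fst.pow 2).continuousOn.div (by fun_prop) h2).neg))

/-- The heat kernel times the spatial cutoff `(1 - z⁴)²`. The cutoff is so flat at `z = 0` that the
error `(∂_z² - ∂_p) (cutHeat z p)` stays bounded up to the singularity of the kernel. -/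
noncomputable def cutHeat (z p : ℝ) : ℝ := (1 - z ^ 4) ^ 2 * heat z p

/-- The first spatial derivative of `cutHeat`. -/
noncomputable def cutHeat₁ (z p : ℝ) : ℝ :=
  (-(8 * z ^ 3 * (1 - z ^ 4)) - (1 - z ^ 4) ^ 2 * (z / (2 * p))) * heat z p

/-- The second spatial derivative of `cutHeat`. -/
noncomputable def cutHeat₂ (z p : ℝ) : ℝ :=
  (-(24 * z ^ 2 * (1 - z ^ 4)) + 32 * z ^ 6 + 8 * z ^ 4 * (1 - z ^ 4) / p +
    (1 - z ^ 4) ^ 2 * (z ^ 2 / (4 * p ^ 2) - 1 / (2 * p))) * heat z p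

/-- The derivative of `cutHeat` in the time variable. -/
noncomputable def cutHeatTime (z p : ℝ) : ℝ :=
  (1 - z ^ 4) ^ 2 * ((z ^ 2 / (4 * p ^ 2) - 1 / (2 * p)) * heat z p)

lemma hasDerivAt_cutHeat (z p : ℝ) :
    HasDerivAt (fun z => cutHeat z p) (cutHeat₁ z p) z := by
  have h : HasDerivAt (fun z : ℝ => (1 - z ^ 4) ^ 2) (-(8 * z ^ 3 * (1 - z ^ 4))) z := by
    refine (((hasDerivAt_pow 4 z).const_sub 1).pow 2).congr_deriv ?_
    norm_num; ring
  refine (h.mul (hasDerivAt_heat_left z p)).congr_deriv ?_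
  rw [cutHeat₁]; ring

lemma hasDerivAt_cutHeat₁ (z : ℝ) {p : ℝ} (hp : 0 < p) :
    HasDerivAt (fun z => cutHeat₁ z p) (cutHeat₂ z p) z := by
  have h1 : HasDerivAt (fun z : ℝ => 1 - z ^ 4) (-(4 * z ^ 3)) z := by
    refine ((hasDerivAt_pow 4 z).const_sub 1).congr_deriv ?_
    norm_num
  have h2 : HasDerivAt (fun z : ℝ => 8 * z ^ 3) (24 * z ^ 2) z := by
    refine ((hasDerivAt_pow 3 z).const_mul 8).congr_deriv ?_
    norm_num; ring
  have h3 := (hasDerivAt_id z).div_const (2 * p)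
  refine ((((h2.mul h1).neg).sub ((h1.pow 2).mul h3)).mul
    (hasDerivAt_heat_left z p)).congr_deriv ?_
  simp only [cutHeat₂, id, Pi.mul_apply, Pi.neg_apply, Pi.sub_apply, Pi.pow_apply]
  field_simp
  ring

lemma hasDerivAt_cutHeat_time (z : ℝ) {p : ℝ} (hp : 0 < p) :
    HasDerivAt (fun p => cutHeat z p) (cutHeatTime z p) p :=
  (hasDerivAt_heat_right z hp).const_mul _

lemma continuousOn_cutHeat : ContinuousOn (Function.uncurry cutHeat) (univ ×ˢ Ioi 0) :=
  ContinuousOn.mul (by fun_prop) continuousOn_heat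

lemma continuousOn_cutHeatTime : ContinuousOn (Function.uncurry cutHeatTime) (univ ×ˢ Ioi 0) := by
  have h1 : ∀ q ∈ (univ : Set ℝ) ×ˢ Ioi (0 : ℝ), 4 * q.2 ^ 2 ≠ 0 := fun q hq =>
    mul_ne_zero four_ne_zero (pow_ne_zero 2 (ne_of_gt hq.2))
  have h2 : ∀ q ∈ (univ : Set ℝ) ×ˢ Ioi (0 : ℝ), 2 * q.2 ≠ 0 := fun q hq =>
    mul_ne_zero two_ne_zero (ne_of_gt hq.2)
  refine ContinuousOn.mul (by fun_prop) (ContinuousOn.mul (ContinuousOn.sub ?_ ?_) continuousOn_heat)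
  · exact ContinuousOn.div (by fun_prop) (by fun_prop) h1
  · exact ContinuousOn.div (by fun_prop) (by fun_prop) h2

lemma continuousOn_cutHeat₂ : ContinuousOn (Function.uncurry cutHeat₂) (univ ×ˢ Ioi 0) := by
  have h0 : ∀ q ∈ (univ : Set ℝ) ×ˢ Ioi (0 : ℝ), q.2 ≠ 0 := fun q hq => ne_of_gt hq.2
  have h1 : ∀ q ∈ (univ : Set ℝ) ×ˢ Ioi (0 : ℝ), 4 * q.2 ^ 2 ≠ 0 := fun q hq =>
    mul_ne_zero four_ne_zero (pow_ne_zero 2 (h0 q hq))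
  have h2 : ∀ q ∈ (univ : Set ℝ) ×ˢ Ioi (0 : ℝ), 2 * q.2 ≠ 0 := fun q hq =>
    mul_ne_zero two_ne_zero (h0 q hq)
  refine ContinuousOn.mul (ContinuousOn.add (ContinuousOn.add (by fun_prop) ?_)
    (ContinuousOn.mul (by fun_prop) (ContinuousOn.sub ?_ ?_))) continuousOn_heat
  · exact ContinuousOn.div (by fun_prop) (by fun_prop) h0
  · exact ContinuousOn.div (by fun_prop) (by fun_prop) h1
  · exact ContinuousOn.div (by fun_prop) (by fun_prop) h2

lemma cutHeat_nonneg (z : ℝ) {p : ℝ} (hp : 0 < p) : 0 ≤ cutHeat z p :=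
  mul_nonneg (sq_nonneg _) (heat_pos z hp).le

lemma pow_four_le_one {z : ℝ} (hz : z ∈ Icc (-1 : ℝ) 1) : z ^ 4 ≤ 1 := by
  have : z ^ 2 ≤ 1 := by nlinarith [hz.1, hz.2]
  nlinarith [sq_nonneg z]

lemma mul_cutHeat_le {z p r : ℝ} (hz : z ∈ Icc (-1 : ℝ) 1) (hp : 0 < p) (hr : r ≤ p) : r * cutHeat z p ≤ √p := by
  have hs : 0 < √p := Real.sqrt_pos.2 hp
  have h4 := pow_four_le_one hz
  have h40 : 0 ≤ z ^ 4 := by positivity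
  have hχ : (1 - z ^ 4) ^ 2 ≤ 1 := by nlinarith
  have hexp : Real.exp (-(z ^ 2 / (4 * p))) ≤ 1 := Real.exp_le_one_iff.2 (by
    have : 0 ≤ z ^ 2 / (4 * p) := by positivity
    linarith)
  have hh : heat z p ≤ (√p)⁻¹ := mul_le_of_le_one_right (inv_nonneg.2 hs.le) hexp
  calc r * cutHeat z p ≤ p * (1 * (√p)⁻¹) := by
        unfold cutHeat
        have := (heat_pos z hp).le
        gcongr
    _ = √p := by
        rw [one_mul, ← div_eq_mul_inv]; exact Real.div_sqrt

/-- In terms of `u = z² / p`, the error terms are `√p` times a polynomial in `u` times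
`exp (-u / 4)`. -/
lemma cutHeat₂_sub_cutHeatTime_le {z p : ℝ} (hz : z ∈ Icc (-1 : ℝ) 1) (hp : 0 < p) :
    cutHeat₂ z p - cutHeatTime z p ≤ 400 * √p := by
  have hs : 0 < √p := Real.sqrt_pos.2 hp
  have h4 := pow_four_le_one hz
  have h40 : 0 ≤ z ^ 4 := by positivity
  set u : ℝ := z ^ 2 / p with hu
  have hu0 : 0 ≤ u := by positivity
  set e : ℝ := Real.exp (-(u / 4)) with he
  have he0 : 0 < e := Real.exp_pos _
  have hheat : heat z p = (√p)⁻¹ * e := by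
    rw [heat, he, hu]; congr 3; field_simp
  have hz2 : z ^ 2 = u * p := by rw [hu]; field_simp
  have hquad : (1 + u / 4 + (u / 4) ^ 2 / 2) * e ≤ 1 := by
    have h := Real.quadratic_le_exp_of_nonneg (show 0 ≤ u / 4 by positivity)
    calc (1 + u / 4 + (u / 4) ^ 2 / 2) * e ≤ Real.exp (u / 4) * e := by gcongr
      _ = 1 := by rw [he, ← Real.exp_add]; simp
  have hue : u * e ≤ 4 := by nlinarith [mul_nonneg (sq_nonneg u) he0.le]
  have hu2e : u ^ 2 * e ≤ 32 := by nlinarith [mul_nonneg hu0 he0.le]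
  have hinv : p * (√p)⁻¹ = √p := by rw [← div_eq_mul_inv]; exact Real.div_sqrt
  have hid : cutHeat₂ z p - cutHeatTime z p =
      (-(24 * z ^ 2 * (1 - z ^ 4)) + 32 * z ^ 6 + 8 * z ^ 4 * (1 - z ^ 4) / p) * heat z p := by
    rw [cutHeat₂, cutHeatTime]; ring
  have hpoly : -(24 * z ^ 2 * (1 - z ^ 4)) + 32 * z ^ 6 + 8 * z ^ 4 * (1 - z ^ 4) / p ≤
      32 * (u * p) + 8 * (u ^ 2 * p) := by
    have e1 : z ^ 4 * (1 - z ^ 4) / p ≤ u ^ 2 * p := by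
      rw [div_le_iff₀ hp]
      have : z ^ 4 = (u * p) ^ 2 := by rw [← hz2]; ring
      nlinarith
    have e2 : z ^ 6 ≤ u * p := by
      rw [← hz2]
      nlinarith [sq_nonneg z]
    have e3 : 0 ≤ z ^ 2 * (1 - z ^ 4) := mul_nonneg (sq_nonneg z) (by linarith)
    have e4 : 8 * z ^ 4 * (1 - z ^ 4) / p = 8 * (z ^ 4 * (1 - z ^ 4) / p) := by ring
    rw [e4]
    linarith
  rw [hid]
  calc _ ≤ (32 * (u * p) + 8 * (u ^ 2 * p)) * heat z p := by
        gcongr; exact (heat_pos z hp).le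
    _ = (32 * (u * e) + 8 * (u ^ 2 * e)) * (p * (√p)⁻¹) := by
        rw [hheat]; ring
    _ = (32 * (u * e) + 8 * (u ^ 2 * e)) * √p := by rw [hinv]
    _ ≤ 400 * √p := by gcongr; linarith

/-- The kernel against which subsolutions are tested: `cutHeat`, shifted in time by `ε`, with
a factor that absorbs a zeroth order term `κ w` and a factor that vanishes at time `τ`. -/
noncomputable def testKernel (κ τ ε z r : ℝ) : ℝ :=
  Real.exp (κ * r) * (1 - r ^ 2 / τ ^ 2) * cutHeat z (r + ε)

/-- The derivative of `testKernel` in the time variable. -/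
noncomputable def testKernelTime (κ τ ε z r : ℝ) : ℝ :=
  (κ * Real.exp (κ * r) * (1 - r ^ 2 / τ ^ 2) + Real.exp (κ * r) * (-(2 * r / τ ^ 2))) *
      cutHeat z (r + ε) +
    Real.exp (κ * r) * (1 - r ^ 2 / τ ^ 2) * cutHeatTime z (r + ε)

lemma hasDerivAt_testKernel (κ τ z : ℝ) {ε r : ℝ} (h : 0 < r + ε) :
    HasDerivAt (fun r => testKernel κ τ ε z r) (testKernelTime κ τ ε z r) r := by
  have h1 : HasDerivAt (fun r => Real.exp (κ * r)) (κ * Real.exp (κ * r)) r := by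
    refine ((hasDerivAt_id r).const_mul κ).exp.congr_deriv ?_
    simp only [id]; ring
  have h2 : HasDerivAt (fun r : ℝ => 1 - r ^ 2 / τ ^ 2) (-(2 * r / τ ^ 2)) r := by
    refine (((hasDerivAt_pow 2 r).div_const (τ ^ 2)).const_sub 1).congr_deriv ?_
    simp
  exact (h1.mul h2).mul ((hasDerivAt_cutHeat_time z h).comp_add_const r ε)

/-- The defect of `testKernel` for the backward equation with zeroth order term `κ`, bounded
uniformly in `ε`: `800` bounds the error of the spatial cutoff, and `4 / τ²` that of the factor
`1 - r² / τ²`, whose derivative vanishes at `r = 0`, where the kernel is singular. -/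
lemma testKernel_defect_le {κ τ ε z r : ℝ} (hκ : 0 ≤ κ) (hτ : 0 < τ) (hτ1 : τ ≤ 1) (hε : 0 < ε)
    (hε1 : ε ≤ 1) (hz : z ∈ Icc (-1 : ℝ) 1) (hr : r ∈ Icc 0 τ) :
    Real.exp (κ * r) * (1 - r ^ 2 / τ ^ 2) * cutHeat₂ z (r + ε) - testKernelTime κ τ ε z r +
      κ * testKernel κ τ ε z r ≤ Real.exp κ * (800 + 4 / τ ^ 2) := by
  have hp : 0 < r + ε := by linarith [hr.1]
  have hsqrt : √(r + ε) ≤ 2 := by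
    rw [Real.sqrt_le_left (by norm_num)]; linarith [hr.2]
  have h1 := cutHeat₂_sub_cutHeatTime_le hz hp
  have h2 := mul_cutHeat_le hz hp (show r ≤ r + ε by linarith)
  have hθ0 : 0 ≤ 1 - r ^ 2 / τ ^ 2 := by
    rw [sub_nonneg, div_le_one (by positivity)]
    have := hr.1; have := hr.2
    gcongr
  have hθ1 : 1 - r ^ 2 / τ ^ 2 ≤ 1 := by
    have : 0 ≤ r ^ 2 / τ ^ 2 := by positivity
    linarith
  have hexp : Real.exp (κ * r) ≤ Real.exp κ := Real.exp_le_exp.2 (by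
    have := hr.2
    nlinarith)
  have hid : Real.exp (κ * r) * (1 - r ^ 2 / τ ^ 2) * cutHeat₂ z (r + ε) -
      testKernelTime κ τ ε z r + κ * testKernel κ τ ε z r =
      Real.exp (κ * r) * ((1 - r ^ 2 / τ ^ 2) * (cutHeat₂ z (r + ε) - cutHeatTime z (r + ε)) +
        2 / τ ^ 2 * (r * cutHeat z (r + ε))) := by
    rw [testKernelTime, testKernel]; ring
  have hb1 : (1 - r ^ 2 / τ ^ 2) * (cutHeat₂ z (r + ε) - cutHeatTime z (r + ε)) ≤ 800 := by
    calc _ ≤ (1 - r ^ 2 / τ ^ 2) * 800 := by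
          gcongr; linarith
      _ ≤ 800 := by linarith
  have hb2 : 2 / τ ^ 2 * (r * cutHeat z (r + ε)) ≤ 4 / τ ^ 2 := by
    calc _ ≤ 2 / τ ^ 2 * 2 := by gcongr; linarith
      _ = 4 / τ ^ 2 := by ring
  rw [hid]
  calc _ ≤ Real.exp (κ * r) * (800 + 4 / τ ^ 2) := by gcongr
    _ ≤ _ := by gcongr

/-- A subsolution of the backward heat equation with a zeroth order term, tested against
`testKernel`: integration by parts leaves the bounded defect of the kernel. -/
lemma integral_testKernel_le {κ τ ε : ℝ} (hκ : 0 ≤ κ) (hτ : 0 < τ) (hτ1 : τ ≤ 1) (hε : 0 < ε)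
    (hε1 : ε ≤ 1) {W Wz Wzz Wr : ℝ → ℝ → ℝ}
    (hW : ContinuousOn (Function.uncurry W) (Icc (-1) 1 ×ˢ Icc 0 τ))
    (hWzz : ContinuousOn (Function.uncurry Wzz) (Icc (-1) 1 ×ˢ Icc 0 τ))
    (hWr : ContinuousOn (Function.uncurry Wr) (Icc (-1) 1 ×ˢ Icc 0 τ))
    (hz : ∀ z ∈ Icc (-1 : ℝ) 1, ∀ r ∈ Icc 0 τ, HasDerivAt (fun z => W z r) (Wz z r) z)
    (hzz : ∀ z ∈ Icc (-1 : ℝ) 1, ∀ r ∈ Icc 0 τ, HasDerivAt (fun z => Wz z r) (Wzz z r) z)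
    (hr : ∀ z ∈ Icc (-1 : ℝ) 1, ∀ r ∈ Icc 0 τ, HasDerivAt (fun r => W z r) (Wr z r) r)
    (hnonneg : ∀ z ∈ Icc (-1 : ℝ) 1, ∀ r ∈ Icc 0 τ, 0 ≤ W z r)
    (hsub : ∀ z ∈ Icc (-1 : ℝ) 1, ∀ r ∈ Icc 0 τ, -Wr z r ≤ Wzz z r + κ * W z r) :
    ∫ z in (-1 : ℝ)..1, testKernel κ τ ε z 0 * W z 0 ≤
      Real.exp κ * (800 + 4 / τ ^ 2) * ∫ r in (0 : ℝ)..τ, ∫ z in (-1 : ℝ)..1, W z r := by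
  set C : ℝ := Real.exp κ * (800 + 4 / τ ^ 2) with hC
  have h11 : (-1 : ℝ) ≤ 1 := by norm_num
  -- continuity of the ingredients on the rectangle
  have hshift {k : ℝ → ℝ → ℝ} (hk : ContinuousOn (Function.uncurry k) (univ ×ˢ Ioi 0)) :
      ContinuousOn (Function.uncurry fun z r => k z (r + ε)) (Icc (-1) 1 ×ˢ Icc 0 τ) :=
    hk.comp (f := fun q : ℝ × ℝ => (q.1, q.2 + ε)) (by fun_prop) fun q hq =>
      ⟨mem_univ _, add_pos_of_nonneg_of_pos hq.2.1 hε⟩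
  have hk0 := hshift continuousOn_cutHeat
  have hk2 := hshift continuousOn_cutHeat₂
  have hkt := hshift continuousOn_cutHeatTime
  have hK : ContinuousOn (Function.uncurry (testKernel κ τ ε)) (Icc (-1) 1 ×ˢ Icc 0 τ) :=
    ContinuousOn.mul (by fun_prop) hk0
  have hKt : ContinuousOn (Function.uncurry (testKernelTime κ τ ε)) (Icc (-1) 1 ×ˢ Icc 0 τ) :=
    (ContinuousOn.mul (by fun_prop) hk0).add (ContinuousOn.mul (by fun_prop) hkt)
  have hD : ContinuousOn (Function.uncurry fun z r =>
      testKernelTime κ τ ε z r * W z r + testKernel κ τ ε z r * Wr z r)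
      (Icc (-1) 1 ×ˢ Icc 0 τ) := (hKt.mul hW).add (hK.mul hWr)
  -- integration in time
  have hpos (r : ℝ) (hr : r ∈ Icc 0 τ) : 0 < r + ε := add_pos_of_nonneg_of_pos hr.1 hε
  have htime (z : ℝ) (hzm : z ∈ Icc (-1 : ℝ) 1) :
      ∫ r in (0 : ℝ)..τ, (testKernelTime κ τ ε z r * W z r + testKernel κ τ ε z r * Wr z r) =
        -(testKernel κ τ ε z 0 * W z 0) := by
    rw [intervalIntegral.integral_eq_sub_of_hasDerivAt
      (f := fun r => testKernel κ τ ε z r * W z r)]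
    · have : testKernel κ τ ε z τ = 0 := by
        rw [testKernel, div_self (by positivity)]; simp
      simp [this]
    · intro r hrm
      rw [uIcc_of_le hτ.le] at hrm
      exact (hasDerivAt_testKernel κ τ z (hpos r hrm)).mul (hr z hzm r hrm)
    · exact (hD.rect_right hzm).intervalIntegrable_Icc hτ.le
  -- integration in space: no boundary terms, since the cutoff has double zeros at the endpoints
  have hG : ContinuousOn (Function.uncurry fun z r =>
      cutHeat z (r + ε) * Wzz z r - cutHeat₂ z (r + ε) * W z r) (Icc (-1) 1 ×ˢ Icc 0 τ) :=
    (hk0.mul hWzz).sub (hk2.mul hW)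
  have hspace (r : ℝ) (hrm : r ∈ Icc 0 τ) : ∫ z in (-1 : ℝ)..1,
      (cutHeat z (r + ε) * Wzz z r - cutHeat₂ z (r + ε) * W z r) = 0 := by
    rw [intervalIntegral.integral_eq_sub_of_hasDerivAt
      (f := fun z => cutHeat z (r + ε) * Wz z r - cutHeat₁ z (r + ε) * W z r)]
    · norm_num [cutHeat, cutHeat₁]
    · intro z hzm
      rw [uIcc_of_le h11] at hzm
      refine (((hasDerivAt_cutHeat z (r + ε)).mul (hzz z hzm r hrm)).sub
        ((hasDerivAt_cutHeat₁ z (hpos r hrm)).mul (hz z hzm r hrm))).congr_deriv ?_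
      ring
    · exact (hG.rect_left hrm).intervalIntegrable_Icc h11
  have hslice (r : ℝ) (hrm : r ∈ Icc 0 τ) : -(C * ∫ z in (-1 : ℝ)..1, W z r) ≤
      ∫ z in (-1 : ℝ)..1,
        (testKernelTime κ τ ε z r * W z r + testKernel κ τ ε z r * Wr z r) := by
    have hi1 := (hG.rect_left hrm).intervalIntegrable_Icc h11
    have hi2 := (hW.rect_left hrm).intervalIntegrable_Icc h11
    have hθ0 : 0 ≤ 1 - r ^ 2 / τ ^ 2 := by
      rw [sub_nonneg, div_le_one (by positivity)]
      have := hrm.1; have := hrm.2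
      gcongr
    have hmono : ∫ z in (-1 : ℝ)..1, (-(Real.exp (κ * r) * (1 - r ^ 2 / τ ^ 2)) *
        (cutHeat z (r + ε) * Wzz z r - cutHeat₂ z (r + ε) * W z r) + -C * W z r) ≤
        ∫ z in (-1 : ℝ)..1,
          (testKernelTime κ τ ε z r * W z r + testKernel κ τ ε z r * Wr z r) := by
      refine intervalIntegral.integral_mono_on h11 ((hi1.const_mul _).add (hi2.const_mul _))
        ((hD.rect_left hrm).intervalIntegrable_Icc h11) fun z hzm => ?_
      have hdef := mul_le_mul_of_nonneg_right (testKernel_defect_le hκ hτ hτ1 hε hε1 hzm hrm)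
        (hnonneg z hzm r hrm)
      have hKnn : 0 ≤ testKernel κ τ ε z r :=
        mul_nonneg (mul_nonneg (Real.exp_pos _).le hθ0) (cutHeat_nonneg z (hpos r hrm))
      have hs := mul_le_mul_of_nonneg_left (hsub z hzm r hrm) hKnn
      rw [← hC] at hdef
      have hKe : testKernel κ τ ε z r =
          Real.exp (κ * r) * (1 - r ^ 2 / τ ^ 2) * cutHeat z (r + ε) := rfl
      rw [hKe] at hs hdef ⊢
      linarith
    rw [intervalIntegral.integral_add (hi1.const_mul _) (hi2.const_mul _),
      intervalIntegral.integral_const_mul, intervalIntegral.integral_const_mul] at hmono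
    have := hspace r hrm
    rw [this] at hmono
    linarith
  have hswap := integral_swap_rect h11 hτ.le hD
  rw [intervalIntegral.integral_congr (g := fun z => -(testKernel κ τ ε z 0 * W z 0))
    (fun z hzm => htime z (by rwa [uIcc_of_le h11] at hzm)), intervalIntegral.integral_neg] at hswap
  have hfinal : ∫ r in (0 : ℝ)..τ, -(C * ∫ z in (-1 : ℝ)..1, W z r) ≤
      ∫ r in (0 : ℝ)..τ, ∫ z in (-1 : ℝ)..1,
        (testKernelTime κ τ ε z r * W z r + testKernel κ τ ε z r * Wr z r) :=
    intervalIntegral.integral_mono_on hτ.le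
      (((continuousOn_integral_rect h11 hτ.le hW).const_mul C).neg.intervalIntegrable_Icc hτ.le)
      ((continuousOn_integral_rect h11 hτ.le hD).intervalIntegrable_Icc hτ.le) hslice
  rw [← hswap, intervalIntegral.integral_neg, intervalIntegral.integral_const_mul] at hfinal
  linarith

/-- The kernel has mass at least `1` near the origin, so the test gives a pointwise bound. -/
lemma le_integral_of_backward_subsolution {κ τ : ℝ} (hκ : 0 ≤ κ) (hτ : 0 < τ) (hτ1 : τ ≤ 1)
    {W Wz Wzz Wr : ℝ → ℝ → ℝ}
    (hW : ContinuousOn (Function.uncurry W) (Icc (-1) 1 ×ˢ Icc 0 τ))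
    (hWzz : ContinuousOn (Function.uncurry Wzz) (Icc (-1) 1 ×ˢ Icc 0 τ))
    (hWr : ContinuousOn (Function.uncurry Wr) (Icc (-1) 1 ×ˢ Icc 0 τ))
    (hz : ∀ z ∈ Icc (-1 : ℝ) 1, ∀ r ∈ Icc 0 τ, HasDerivAt (fun z => W z r) (Wz z r) z)
    (hzz : ∀ z ∈ Icc (-1 : ℝ) 1, ∀ r ∈ Icc 0 τ, HasDerivAt (fun z => Wz z r) (Wzz z r) z)
    (hr : ∀ z ∈ Icc (-1 : ℝ) 1, ∀ r ∈ Icc 0 τ, HasDerivAt (fun r => W z r) (Wr z r) r)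
    (hnonneg : ∀ z ∈ Icc (-1 : ℝ) 1, ∀ r ∈ Icc 0 τ, 0 ≤ W z r)
    (hsub : ∀ z ∈ Icc (-1 : ℝ) 1, ∀ r ∈ Icc 0 τ, -Wr z r ≤ Wzz z r + κ * W z r) :
    W 0 0 ≤ Real.exp κ * (800 + 4 / τ ^ 2) * ∫ r in (0 : ℝ)..τ, ∫ z in (-1 : ℝ)..1, W z r := by
  set I : ℝ := Real.exp κ * (800 + 4 / τ ^ 2) * ∫ r in (0 : ℝ)..τ, ∫ z in (-1 : ℝ)..1, W z r
  by_contra! hlt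
  have h0τ : (0 : ℝ) ∈ Icc 0 τ := ⟨le_rfl, hτ.le⟩
  have h01 : (0 : ℝ) ∈ Icc (-1 : ℝ) 1 := by constructor <;> norm_num
  have hI0 : 0 ≤ I := by
    refine mul_nonneg (by positivity) (intervalIntegral.integral_nonneg hτ.le fun r hrm =>
      intervalIntegral.integral_nonneg (by norm_num) fun z hzm => hnonneg z hzm r hrm)
  have hWc := hW.rect_left h0τ
  -- near the origin `W` times the cutoff stays above a number larger than `I`
  have hev : ∀ᶠ z in 𝓝 (0 : ℝ), I < (1 - z ^ 4) ^ 2 * W z 0 := by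
    have hca : ContinuousAt (fun z => (1 - z ^ 4) ^ 2 * W z 0) 0 :=
      ContinuousAt.mul (by fun_prop) (hWc.continuousAt (Icc_mem_nhds (by norm_num) (by norm_num)))
    exact hca.eventually (lt_mem_nhds (by simpa using hlt))
  obtain ⟨δ, hδ, hball⟩ := Metric.eventually_nhds_iff.1 hev
  set η : ℝ := min (δ / 2) 1 with hη
  have hη0 : 0 < η := by positivity
  have hη1 : η ≤ 1 := min_le_right _ _
  have hηδ : η < δ := (min_le_left _ _).trans_lt (by linarith)
  have hε1 : η ^ 2 ≤ 1 := pow_le_one₀ hη0.le hη1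
  have hle := integral_testKernel_le hκ hτ hτ1 (show 0 < η ^ 2 by positivity) hε1 hW hWzz hWr
    hz hzz hr hnonneg hsub
  have hKeq (z : ℝ) : testKernel κ τ (η ^ 2) z 0 = (1 - z ^ 4) ^ 2 * heat z (η ^ 2) := by
    simp [testKernel, cutHeat]
  have hKc : Continuous fun z => testKernel κ τ (η ^ 2) z 0 := by
    simp_rw [hKeq]
    unfold heat
    have : (4 * η ^ 2) ≠ 0 := by positivity
    fun_prop
  have hint : ContinuousOn (fun z => testKernel κ τ (η ^ 2) z 0 * W z 0) (Icc (-1) 1) :=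
    hKc.continuousOn.mul hWc
  have hnn (z : ℝ) (hzm : z ∈ Icc (-1 : ℝ) 1) : 0 ≤ testKernel κ τ (η ^ 2) z 0 * W z 0 := by
    rw [hKeq]
    exact mul_nonneg (cutHeat_nonneg z (by positivity)) (hnonneg z hzm 0 h0τ)
  have hsubset : ∫ z in (-η)..η, testKernel κ τ (η ^ 2) z 0 * W z 0 ≤
      ∫ z in (-1 : ℝ)..1, testKernel κ τ (η ^ 2) z 0 * W z 0 := by
    refine intervalIntegral.integral_mono_interval (by linarith) (by linarith) hη1 ?_
      (hint.intervalIntegrable_Icc (by norm_num))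
    rw [EventuallyLE, ae_restrict_iff' measurableSet_Ioc]
    exact Eventually.of_forall fun z hzm => hnn z ⟨hzm.1.le, hzm.2⟩
  -- on `[-η, η]` the kernel is at least `1 / (2η)`
  have hheat (z : ℝ) (hzm : z ∈ Icc (-η) η) : 1 / (2 * η) ≤ heat z (η ^ 2) := by
    have hz2 : z ^ 2 ≤ η ^ 2 := by nlinarith [hzm.1, hzm.2]
    have hexp : 1 / 2 ≤ Real.exp (-(z ^ 2 / (4 * η ^ 2))) := by
      have h1 : z ^ 2 / (4 * η ^ 2) ≤ 1 / 4 := by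
        rw [div_le_div_iff₀ (by positivity) (by norm_num)]; linarith
      linarith [Real.add_one_le_exp (-(z ^ 2 / (4 * η ^ 2)))]
    rw [heat, Real.sqrt_sq hη0.le]
    calc 1 / (2 * η) = η⁻¹ * (1 / 2) := by field_simp
      _ ≤ _ := by gcongr
  have hlow : ∫ _ in (-η)..η, I * (1 / (2 * η)) <
      ∫ z in (-η)..η, testKernel κ τ (η ^ 2) z 0 * W z 0 := by
    refine intervalIntegral.integral_lt_integral_of_continuousOn_of_le_of_exists_lt
      (by linarith) continuousOn_const (hint.mono (Icc_subset_Icc (by linarith) hη1)) ?_ ?_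
    · intro z hzm
      have hzm' : z ∈ Icc (-η) η := ⟨hzm.1.le, hzm.2⟩
      have hb := (hball (y := z) (by
        rw [Real.dist_eq, sub_zero]
        exact (abs_le.2 hzm').trans_lt hηδ)).le
      calc I * (1 / (2 * η)) ≤ ((1 - z ^ 4) ^ 2 * W z 0) * heat z (η ^ 2) :=
            mul_le_mul hb (hheat z hzm') (by positivity) (hI0.trans hb)
        _ = _ := by rw [hKeq]; ring
    · refine ⟨0, ⟨by linarith, hη0.le⟩, ?_⟩
      have hb := hball (y := 0) (by simpa using hδ)
      calc I * (1 / (2 * η)) < ((1 - 0 ^ 4) ^ 2 * W 0 0) * heat 0 (η ^ 2) :=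
            mul_lt_mul hb (hheat 0 ⟨by linarith, hη0.le⟩) (by positivity) (hI0.trans hb.le)
        _ = _ := by rw [hKeq]; ring
  rw [intervalIntegral.integral_const, smul_eq_mul] at hlow
  have : (η - -η) * (I * (1 / (2 * η))) = I := by field_simp; ring
  linarith

/-- The mean value inequality: a nonnegative function with `∂_t w ≤ ∂_x² w + κ w` is bounded at
a point by its integral over a parabolic cylinder below that point. -/
theorem le_integral_of_subsolution {κ τ : ℝ} (hκ : 0 ≤ κ) (hτ : 0 < τ) (hτ1 : τ ≤ 1)
    {w wx wxx wt : ℝ → ℝ → ℝ} {x₀ t₀ : ℝ} (ht₀ : τ < t₀)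
    (hw : ContinuousOn (Function.uncurry w) (univ ×ˢ Ioi 0))
    (hwxx : ContinuousOn (Function.uncurry wxx) (univ ×ˢ Ioi 0))
    (hwt : ContinuousOn (Function.uncurry wt) (univ ×ˢ Ioi 0))
    (hx : ∀ x, ∀ t > 0, HasDerivAt (fun x => w x t) (wx x t) x)
    (hxx : ∀ x, ∀ t > 0, HasDerivAt (fun x => wx x t) (wxx x t) x)
    (ht : ∀ x, ∀ t > 0, HasDerivAt (fun t => w x t) (wt x t) t)
    (hnonneg : ∀ x, ∀ t > 0, 0 ≤ w x t)
    (hsub : ∀ x, ∀ t > 0, wt x t ≤ wxx x t + κ * w x t) :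
    w x₀ t₀ ≤ Real.exp κ * (800 + 4 / τ ^ 2) *
      ∫ t in (t₀ - τ)..t₀, ∫ x in (x₀ - 1)..(x₀ + 1), w x t := by
  have hpos (r : ℝ) (hr : r ∈ Icc 0 τ) : 0 < t₀ - r := by linarith [hr.2]
  have hcomp {k : ℝ → ℝ → ℝ} (hk : ContinuousOn (Function.uncurry k) (univ ×ˢ Ioi 0)) :
      ContinuousOn (Function.uncurry fun z r => k (x₀ + z) (t₀ - r)) (Icc (-1) 1 ×ˢ Icc 0 τ) :=
    hk.comp (f := fun q : ℝ × ℝ => (x₀ + q.1, t₀ - q.2)) (by fun_prop) fun q hq =>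
      ⟨mem_univ _, hpos _ hq.2⟩
  have h := le_integral_of_backward_subsolution hκ hτ hτ1
    (W := fun z r => w (x₀ + z) (t₀ - r)) (Wz := fun z r => wx (x₀ + z) (t₀ - r))
    (Wzz := fun z r => wxx (x₀ + z) (t₀ - r)) (Wr := fun z r => -wt (x₀ + z) (t₀ - r))
    (hcomp hw) (hcomp hwxx) (hcomp hwt).neg
    (fun z _ r hr => (hx (x₀ + z) (t₀ - r) (hpos r hr)).comp_const_add x₀ z)
    (fun z _ r hr => (hxx (x₀ + z) (t₀ - r) (hpos r hr)).comp_const_add x₀ z)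
    (fun z _ r hr => (ht (x₀ + z) (t₀ - r) (hpos r hr)).comp_const_sub t₀ r)
    (fun z _ r hr => hnonneg _ _ (hpos r hr))
    (fun z _ r hr => by simpa using hsub (x₀ + z) (t₀ - r) (hpos r hr))
  have h1 (t : ℝ) : ∫ z in (-1 : ℝ)..1, w (x₀ + z) t = ∫ x in (x₀ - 1)..(x₀ + 1), w x t := by
    rw [intervalIntegral.integral_comp_add_left (fun x => w x t) x₀, ← sub_eq_add_neg]
  simp only [add_zero, sub_zero, h1] at h
  rwa [intervalIntegral.integral_comp_sub_left
    (fun t => ∫ x in (x₀ - 1)..(x₀ + 1), w x t) t₀, sub_zero] at h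

/-! ### Pointwise bounds for solutions of the Fokker–Planck equation -/

/-- A classical solution together with its derivatives, so that sums and translates of solutions
are solutions by termwise inspection. -/
structure IsSolution (φ : ℝ → ℝ) (f : ℝ) (v vx vxx vt : ℝ → ℝ → ℝ) : Prop where
  hasDerivAt_x : ∀ x, ∀ t > 0, HasDerivAt (fun x => v x t) (vx x t) x
  hasDerivAt_xx : ∀ x, ∀ t > 0, HasDerivAt (fun x => vx x t) (vxx x t) x
  hasDerivAt_t : ∀ x, ∀ t > 0, HasDerivAt (fun t => v x t) (vt x t) t
  continuousOn : ContinuousOn (Function.uncurry v) (univ ×ˢ Ioi 0)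
  continuousOn_x : ContinuousOn (Function.uncurry vx) (univ ×ˢ Ioi 0)
  continuousOn_xx : ContinuousOn (Function.uncurry vxx) (univ ×ˢ Ioi 0)
  continuousOn_t : ContinuousOn (Function.uncurry vt) (univ ×ˢ Ioi 0)
  equation : ∀ x, ∀ t > 0,
    vt x t = deriv (deriv φ) x * v x t + (deriv φ x - f) * vx x t + vxx x t

section Solutions

variable {φ : ℝ → ℝ} {f : ℝ}

lemma FokkerPlanck.isSolution (hφ : ContDiff ℝ 2 φ) {v : ℝ → ℝ → ℝ} (hv : FokkerPlanck φ f v) :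
    IsSolution φ f v (fun x t => deriv (fun x => v x t) x)
      (fun x t => iteratedDeriv 2 (fun x => v x t) x) (fun x t => deriv (fun s => v x s) t) := by
  have hx (x t : ℝ) (ht : 0 < t) : HasDerivAt (fun x => v x t) (deriv (fun x => v x t) x) x :=
    ((hv.contDiff_space t ht).differentiable (by norm_num)).differentiableAt.hasDerivAt
  have hxx (x t : ℝ) (ht : 0 < t) : HasDerivAt (fun x => deriv (fun x => v x t) x)
      (iteratedDeriv 2 (fun x => v x t) x) x := by
    have h1 : ContDiff ℝ 1 (deriv fun x => v x t) :=
      ((contDiff_succ_iff_deriv (n := 1)).1 (hv.contDiff_space t ht)).2.2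
    have h2 := ((h1.differentiable (by norm_num)) x).hasDerivAt
    rwa [show iteratedDeriv 2 (fun x => v x t) = deriv (deriv fun x => v x t) by
      rw [iteratedDeriv_succ, iteratedDeriv_one]]
  refine ⟨hx, hxx, fun x t ht => (hv.differentiableAt_time x t ht).hasDerivAt, hv.continuousOn,
    hv.continuousOn_dx, hv.continuousOn_dxx, hv.continuousOn_dt, fun x t ht => ?_⟩
  have h := (((hasDerivAt_deriv_potential hφ x).sub_const f).mul (hx x t ht)).add (hxx x t ht)
  exact (hv.equation x t ht).unique h

lemma IsSolution.zero : IsSolution φ f (fun _ _ => 0) (fun _ _ => 0) (fun _ _ => 0)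
    (fun _ _ => 0) :=
  ⟨fun _ _ _ => hasDerivAt_const _ _, fun _ _ _ => hasDerivAt_const _ _,
    fun _ _ _ => hasDerivAt_const _ _, continuousOn_const, continuousOn_const, continuousOn_const,
    continuousOn_const, fun _ _ _ => by ring⟩

lemma IsSolution.add {v vx vxx vt w wx wxx wt : ℝ → ℝ → ℝ} (hv : IsSolution φ f v vx vxx vt)
    (hw : IsSolution φ f w wx wxx wt) :
    IsSolution φ f (fun x t => v x t + w x t) (fun x t => vx x t + wx x t)
      (fun x t => vxx x t + wxx x t) (fun x t => vt x t + wt x t) :=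
  ⟨fun x t ht => (hv.hasDerivAt_x x t ht).add (hw.hasDerivAt_x x t ht),
    fun x t ht => (hv.hasDerivAt_xx x t ht).add (hw.hasDerivAt_xx x t ht),
    fun x t ht => (hv.hasDerivAt_t x t ht).add (hw.hasDerivAt_t x t ht),
    hv.continuousOn.add hw.continuousOn, hv.continuousOn_x.add hw.continuousOn_x,
    hv.continuousOn_xx.add hw.continuousOn_xx, hv.continuousOn_t.add hw.continuousOn_t,
    fun x t ht => by rw [hv.equation x t ht, hw.equation x t ht]; ring⟩

lemma IsSolution.sub {v vx vxx vt w wx wxx wt : ℝ → ℝ → ℝ} (hv : IsSolution φ f v vx vxx vt)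
    (hw : IsSolution φ f w wx wxx wt) :
    IsSolution φ f (fun x t => v x t - w x t) (fun x t => vx x t - wx x t)
      (fun x t => vxx x t - wxx x t) (fun x t => vt x t - wt x t) :=
  ⟨fun x t ht => (hv.hasDerivAt_x x t ht).sub (hw.hasDerivAt_x x t ht),
    fun x t ht => (hv.hasDerivAt_xx x t ht).sub (hw.hasDerivAt_xx x t ht),
    fun x t ht => (hv.hasDerivAt_t x t ht).sub (hw.hasDerivAt_t x t ht),
    hv.continuousOn.sub hw.continuousOn, hv.continuousOn_x.sub hw.continuousOn_x,
    hv.continuousOn_xx.sub hw.continuousOn_xx, hv.continuousOn_t.sub hw.continuousOn_t,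
    fun x t ht => by rw [hv.equation x t ht, hw.equation x t ht]; ring⟩

lemma IsSolution.sum {ι : Type*} (s : Finset ι) {v vx vxx vt : ι → ℝ → ℝ → ℝ}
    (hv : ∀ i, IsSolution φ f (v i) (vx i) (vxx i) (vt i)) :
    IsSolution φ f (fun x t => ∑ i ∈ s, v i x t) (fun x t => ∑ i ∈ s, vx i x t)
      (fun x t => ∑ i ∈ s, vxx i x t) (fun x t => ∑ i ∈ s, vt i x t) := by
  classical
  induction s using Finset.induction_on with
  | empty => simpa using IsSolution.zero
  | insert i s hi ih => simpa only [Finset.sum_insert hi] using (hv i).add ih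

lemma IsSolution.translate (hper : Function.Periodic φ 1) {v vx vxx vt : ℝ → ℝ → ℝ}
    (hv : IsSolution φ f v vx vxx vt) (j : ℤ) :
    IsSolution φ f (fun x t => v (j + x) t) (fun x t => vx (j + x) t)
      (fun x t => vxx (j + x) t) (fun x t => vt (j + x) t) := by
  have hc {k : ℝ → ℝ → ℝ} (hk : ContinuousOn (Function.uncurry k) (univ ×ˢ Ioi 0)) :
      ContinuousOn (Function.uncurry fun x t => k (j + x) t) (univ ×ˢ Ioi 0) :=
    hk.comp (f := fun q : ℝ × ℝ => ((j : ℝ) + q.1, q.2)) (by fun_prop) fun q hq =>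
      ⟨mem_univ _, hq.2⟩
  have hshift {g : ℝ → ℝ} (hg : Function.Periodic g 1) (x : ℝ) : g (j + x) = g x := by
    have := hg.int_mul j x
    rwa [mul_one, add_comm] at this
  refine ⟨fun x t ht => (hv.hasDerivAt_x _ t ht).comp_const_add (j : ℝ) x,
    fun x t ht => (hv.hasDerivAt_xx _ t ht).comp_const_add (j : ℝ) x,
    fun x t ht => hv.hasDerivAt_t _ t ht, hc hv.continuousOn, hc hv.continuousOn_x,
    hc hv.continuousOn_xx, hc hv.continuousOn_t, fun x t ht => ?_⟩
  rw [hv.equation _ t ht, hshift (periodic_deriv hper), hshift (periodic_deriv (periodic_deriv hper))]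

/-- A common bound for the drift coefficient and its derivative. -/
lemma exists_drift_bound (hφ : ContDiff ℝ 2 φ) (hper : Function.Periodic φ 1) (f : ℝ) :
    ∃ B, 0 ≤ B ∧ (∀ x, |deriv φ x - f| ≤ B) ∧ ∀ x, |deriv (deriv φ) x| ≤ B := by
  have hb {g : ℝ → ℝ} (hg : Continuous g) (hgp : Function.Periodic g 1) : ∃ C, ∀ x, |g x| ≤ C := by
    obtain ⟨C, hC⟩ := isCompact_Icc.exists_bound_of_continuousOn
      (s := Icc (0 : ℝ) (0 + 1)) hg.continuousOn
    refine ⟨C, fun x => ?_⟩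
    obtain ⟨y, hy, hxy⟩ := hgp.exists_mem_Ico zero_lt_one x 0
    rw [hxy]
    exact hC y ⟨hy.1, hy.2.le⟩
  obtain ⟨C₁, h₁⟩ := hb ((continuous_deriv_potential hφ).sub continuous_const)
    (g := fun x => deriv φ x - f) fun x => by simp only [periodic_deriv hper x]
  obtain ⟨C₂, h₂⟩ := hb (continuous_deriv_deriv_potential hφ)
    (periodic_deriv (periodic_deriv hper))
  refine ⟨max C₁ C₂, ?_, fun x => (h₁ x).trans (le_max_left _ _),
    fun x => (h₂ x).trans (le_max_right _ _)⟩
  exact (abs_nonneg _).trans ((h₁ 0).trans (le_max_left _ _))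

/-- The constant in the mean value inequality for solutions, in terms of the bound `B` of
`exists_drift_bound` and the height `τ` of the cylinder. -/
noncomputable def cylinderConst (B τ : ℝ) : ℝ :=
  Real.exp B * (800 + 4 / τ ^ 2) * Real.exp B

lemma cylinderConst_nonneg (B τ : ℝ) : 0 ≤ cylinderConst B τ := by
  unfold cylinderConst; positivity

lemma tilted_sub_le (hφ : ContDiff ℝ 2 φ) {B : ℝ} (hb : ∀ x, |deriv φ x - f| ≤ B) (x y : ℝ) :
    |tilted φ f y - tilted φ f x| ≤ B * |y - x| := by
  have := Convex.norm_image_sub_le_of_norm_hasDerivWithin_le (f := tilted φ f)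
    (f' := fun x => deriv φ x - f) (s := univ) (C := B) (x := x) (y := y)
    (fun z _ => (hasDerivAt_tilted hφ z).hasDerivWithinAt) (fun z _ => hb z) convex_univ
    (mem_univ _) (mem_univ _)
  simpa using this

/-- Derivatives of a solution multiplied by the square root of the integrating factor,
`exp ((tilted φ f x - c) / 2)`: this removes the first order term of the equation. -/
lemma IsSolution.hasDerivAt_gauge (hφ : ContDiff ℝ 2 φ) {v vx vxx vt : ℝ → ℝ → ℝ}
    (hv : IsSolution φ f v vx vxx vt) (c x : ℝ) {t : ℝ} (ht : 0 < t) :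
    HasDerivAt (fun x => Real.exp ((tilted φ f x - c) / 2) * v x t)
      (Real.exp ((tilted φ f x - c) / 2) * ((deriv φ x - f) / 2 * v x t + vx x t)) x ∧
    HasDerivAt (fun x => Real.exp ((tilted φ f x - c) / 2) *
        ((deriv φ x - f) / 2 * v x t + vx x t))
      (Real.exp ((tilted φ f x - c) / 2) *
        (vt x t + ((deriv φ x - f) ^ 2 / 4 - deriv (deriv φ) x / 2) * v x t)) x := by
  have he : HasDerivAt (fun x => Real.exp ((tilted φ f x - c) / 2))
      (Real.exp ((tilted φ f x - c) / 2) * ((deriv φ x - f) / 2)) x :=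
    (((hasDerivAt_tilted hφ x).sub_const c).div_const 2).exp
  have hb : HasDerivAt (fun x => (deriv φ x - f) / 2) (deriv (deriv φ) x / 2) x :=
    ((hasDerivAt_deriv_potential hφ x).sub_const f).div_const 2
  refine ⟨(he.mul (hv.hasDerivAt_x x t ht)).congr_deriv (by ring), ?_⟩
  refine (he.mul ((hb.mul (hv.hasDerivAt_x x t ht)).add (hv.hasDerivAt_xx x t ht))).congr_deriv ?_
  rw [hv.equation x t ht]
  simp only [Pi.add_apply, Pi.mul_apply]
  ring

lemma continuousOn_gauge (hφ : ContDiff ℝ 2 φ) (c : ℝ) {k : ℝ → ℝ → ℝ}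
    (hk : ContinuousOn (Function.uncurry k) (univ ×ˢ Ioi 0)) :
    ContinuousOn (Function.uncurry fun x t => Real.exp ((tilted φ f x - c) / 2) * k x t)
      (univ ×ˢ Ioi 0) := by
  have := (contDiff_tilted (f := f) hφ).continuous
  have h : Continuous fun q : ℝ × ℝ => Real.exp ((tilted φ f q.1 - c) / 2) := by fun_prop
  exact h.continuousOn.mul hk

lemma gauge_le (hφ : ContDiff ℝ 2 φ) {B : ℝ} (hB : 0 ≤ B) (hb : ∀ x, |deriv φ x - f| ≤ B)
    {x₀ x : ℝ} (hx : x ∈ Icc (x₀ - 1) (x₀ + 1)) :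
    Real.exp ((tilted φ f x - tilted φ f x₀) / 2) ≤ Real.exp (B / 2) := by
  refine Real.exp_le_exp.2 ?_
  have h1 := (le_abs_self _).trans (tilted_sub_le hφ hb x₀ x)
  have h2 : |x - x₀| ≤ 1 := abs_le.2 ⟨by linarith [hx.1], by linarith [hx.2]⟩
  have := mul_le_mul_of_nonneg_left h2 hB
  linarith

/-- If `W ≤ C * v` on a cylinder below `(x₀, t₀)`, the same holds for the integrals. -/
lemma integral_cylinder_le {W V : ℝ → ℝ → ℝ} {C τ x₀ t₀ : ℝ} (hτ : 0 < τ) (ht₀ : τ < t₀)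
    (hW : ContinuousOn (Function.uncurry W) (univ ×ˢ Ioi 0))
    (hV : ContinuousOn (Function.uncurry V) (univ ×ˢ Ioi 0))
    (hle : ∀ x ∈ Icc (x₀ - 1) (x₀ + 1), ∀ t > 0, W x t ≤ C * V x t) :
    ∫ t in (t₀ - τ)..t₀, ∫ x in (x₀ - 1)..(x₀ + 1), W x t ≤
      C * ∫ t in (t₀ - τ)..t₀, ∫ x in (x₀ - 1)..(x₀ + 1), V x t := by
  have hsub : Icc (x₀ - 1) (x₀ + 1) ×ˢ Icc (t₀ - τ) t₀ ⊆ univ ×ˢ Ioi (0 : ℝ) := fun q hq =>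
    ⟨mem_univ _, by have := hq.2.1; simp only [mem_Ioi]; linarith⟩
  have hx : x₀ - 1 ≤ x₀ + 1 := by linarith
  have ht : t₀ - τ ≤ t₀ := by linarith
  rw [← intervalIntegral.integral_const_mul]
  refine intervalIntegral.integral_mono_on ht
    ((continuousOn_integral_rect hx ht (hW.mono hsub)).intervalIntegrable_Icc ht)
    (((continuousOn_integral_rect hx ht (hV.mono hsub)).const_mul C).intervalIntegrable_Icc ht)
    fun t htm => ?_
  rw [← intervalIntegral.integral_const_mul]
  exact intervalIntegral.integral_mono_on hx
    (((hW.mono hsub).rect_left htm).intervalIntegrable_Icc hx)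
    ((((hV.mono hsub).rect_left htm).const_mul C).intervalIntegrable_Icc hx)
    fun x hxm => hle x hxm t (by linarith [htm.1])

/-- Nonnegative solutions are bounded pointwise by local space-time averages. -/
theorem IsSolution.le_integral (hφ : ContDiff ℝ 2 φ) {B : ℝ} (hB : 0 ≤ B)
    (hb : ∀ x, |deriv φ x - f| ≤ B) (hb' : ∀ x, |deriv (deriv φ) x| ≤ B) {v vx vxx vt : ℝ → ℝ → ℝ}
    (hv : IsSolution φ f v vx vxx vt) (hnonneg : ∀ x, ∀ t > 0, 0 ≤ v x t) {τ x₀ t₀ : ℝ}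
    (hτ : 0 < τ) (hτ1 : τ ≤ 1) (ht₀ : τ < t₀) :
    v x₀ t₀ ≤ cylinderConst B τ *
      ∫ t in (t₀ - τ)..t₀, ∫ x in (x₀ - 1)..(x₀ + 1), v x t := by
  set c := tilted φ f x₀ with hc
  have hcd := continuous_deriv_potential hφ
  have hcdd := continuous_deriv_deriv_potential hφ
  have hpot : Continuous fun q : ℝ × ℝ => (deriv φ q.1 - f) ^ 2 / 4 - deriv (deriv φ) q.1 / 2 := by
    fun_prop
  have hg2 : ContinuousOn (Function.uncurry fun x t =>
      vt x t + ((deriv φ x - f) ^ 2 / 4 - deriv (deriv φ) x / 2) * v x t) (univ ×ˢ Ioi 0) :=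
    hv.continuousOn_t.add (hpot.continuousOn.mul hv.continuousOn)
  have h := le_integral_of_subsolution hB hτ hτ1 (x₀ := x₀) ht₀
    (w := fun x t => Real.exp ((tilted φ f x - c) / 2) * v x t)
    (wt := fun x t => Real.exp ((tilted φ f x - c) / 2) * vt x t)
    (continuousOn_gauge hφ c hv.continuousOn)
    (continuousOn_gauge hφ c hg2)
    (continuousOn_gauge hφ c hv.continuousOn_t)
    (fun x t ht => (hv.hasDerivAt_gauge hφ c x ht).1)
    (fun x t ht => (hv.hasDerivAt_gauge hφ c x ht).2)
    (fun x t ht => (hv.hasDerivAt_t x t ht).const_mul _)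
    (fun x t ht => mul_nonneg (Real.exp_pos _).le (hnonneg x t ht))
    (fun x t ht => by
      have h0 := mul_nonneg (Real.exp_pos ((tilted φ f x - c) / 2)).le (hnonneg x t ht)
      have h1 : 0 ≤ (deriv φ x - f) ^ 2 / 4 - deriv (deriv φ) x / 2 + B := by
        have := (le_abs_self _).trans (hb' x)
        nlinarith [sq_nonneg (deriv φ x - f)]
      have := mul_nonneg h1 h0
      linarith)
  have h2 := integral_cylinder_le (x₀ := x₀) (C := Real.exp B) hτ ht₀
    (continuousOn_gauge (f := f) hφ c hv.continuousOn) hv.continuousOn fun x hx t ht => by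
      have := (gauge_le hφ hB hb hx).trans (Real.exp_le_exp.2 (show B / 2 ≤ B by linarith))
      have := hnonneg x t ht
      gcongr
  have h3 : (0 : ℝ) ≤ Real.exp B * (800 + 4 / τ ^ 2) := by positivity
  have h4 := h.trans (mul_le_mul_of_nonneg_left h2 h3)
  simp only [← hc, sub_self, zero_div, Real.exp_zero, one_mul] at h4
  rw [cylinderConst]
  linarith

/-- The square of a solution is bounded pointwise by its local space-time averages: after the
gauge transformation, it is a subsolution. -/
theorem IsSolution.sq_le_integral (hφ : ContDiff ℝ 2 φ) {B : ℝ} (hB : 0 ≤ B)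
    (hb : ∀ x, |deriv φ x - f| ≤ B) (hb' : ∀ x, |deriv (deriv φ) x| ≤ B) {v vx vxx vt : ℝ → ℝ → ℝ}
    (hv : IsSolution φ f v vx vxx vt) {τ x₀ t₀ : ℝ} (hτ : 0 < τ) (hτ1 : τ ≤ 1) (ht₀ : τ < t₀) :
    v x₀ t₀ ^ 2 ≤ cylinderConst B τ *
      ∫ t in (t₀ - τ)..t₀, ∫ x in (x₀ - 1)..(x₀ + 1), v x t ^ 2 := by
  set c := tilted φ f x₀ with hc
  have hcd := continuous_deriv_potential hφ
  have hcdd := continuous_deriv_deriv_potential hφ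
  have hpot : Continuous fun q : ℝ × ℝ => (deriv φ q.1 - f) ^ 2 / 4 - deriv (deriv φ) q.1 / 2 := by
    fun_prop
  have hdrift : Continuous fun q : ℝ × ℝ => (deriv φ q.1 - f) / 2 := by fun_prop
  have hg0 := continuousOn_gauge (f := f) hφ c hv.continuousOn
  have hg1 := continuousOn_gauge (f := f) hφ c
    (k := fun x t => (deriv φ x - f) / 2 * v x t + vx x t)
    ((hdrift.continuousOn.fun_mul hv.continuousOn).fun_add hv.continuousOn_x)
  have hg2 := continuousOn_gauge (f := f) hφ c
    (k := fun x t => vt x t + ((deriv φ x - f) ^ 2 / 4 - deriv (deriv φ) x / 2) * v x t)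
    (hv.continuousOn_t.fun_add (hpot.continuousOn.fun_mul hv.continuousOn))
  have hgt := continuousOn_gauge (f := f) hφ c hv.continuousOn_t
  have h := le_integral_of_subsolution hB hτ hτ1 (x₀ := x₀) ht₀
    (w := fun x t => (Real.exp ((tilted φ f x - c) / 2) * v x t) ^ 2)
    (wx := fun x t => 2 * (Real.exp ((tilted φ f x - c) / 2) * v x t) *
      (Real.exp ((tilted φ f x - c) / 2) * ((deriv φ x - f) / 2 * v x t + vx x t)))
    (wxx := fun x t => 2 *
        (Real.exp ((tilted φ f x - c) / 2) * ((deriv φ x - f) / 2 * v x t + vx x t)) ^ 2 +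
      2 * (Real.exp ((tilted φ f x - c) / 2) * v x t) * (Real.exp ((tilted φ f x - c) / 2) *
        (vt x t + ((deriv φ x - f) ^ 2 / 4 - deriv (deriv φ) x / 2) * v x t)))
    (wt := fun x t => 2 * (Real.exp ((tilted φ f x - c) / 2) * v x t) *
      (Real.exp ((tilted φ f x - c) / 2) * vt x t))
    (hg0.fun_pow 2) (((hg1.fun_pow 2).const_mul 2).fun_add ((hg0.const_mul 2).fun_mul hg2))
    ((hg0.const_mul 2).fun_mul hgt)
    (fun x t ht => ((hv.hasDerivAt_gauge hφ c x ht).1.pow 2).congr_deriv (by norm_num))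
    (fun x t ht => (((hv.hasDerivAt_gauge hφ c x ht).1.const_mul 2).mul
      (hv.hasDerivAt_gauge hφ c x ht).2).congr_deriv (by ring))
    (fun x t ht => (((hv.hasDerivAt_t x t ht).const_mul _).pow 2).congr_deriv (by norm_num))
    (fun x t ht => sq_nonneg _)
    (fun x t ht => by
      have h0 := sq_nonneg (Real.exp ((tilted φ f x - c) / 2) * v x t)
      have h1 : 0 ≤ 2 * ((deriv φ x - f) ^ 2 / 4 - deriv (deriv φ) x / 2) + B := by
        have := (le_abs_self _).trans (hb' x)
        nlinarith [sq_nonneg (deriv φ x - f)]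
      have h2 := mul_nonneg h1 h0
      have h3 := sq_nonneg (Real.exp ((tilted φ f x - c) / 2) *
        ((deriv φ x - f) / 2 * v x t + vx x t))
      linarith)
  have h2 := integral_cylinder_le (x₀ := x₀) (C := Real.exp B) hτ ht₀
    (hg0.fun_pow 2) (hv.continuousOn.fun_pow 2) (V := fun x t => v x t ^ 2)
    (W := fun x t => (Real.exp ((tilted φ f x - c) / 2) * v x t) ^ 2) fun x hx t ht => by
      have he := gauge_le hφ hB hb hx
      calc _ = Real.exp ((tilted φ f x - c) / 2) ^ 2 * v x t ^ 2 := by ring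
        _ ≤ Real.exp (B / 2) ^ 2 * v x t ^ 2 := by gcongr
        _ = _ := by rw [← Real.exp_nat_mul]; congr 2; push_cast; ring
  have h3 : (0 : ℝ) ≤ Real.exp B * (800 + 4 / τ ^ 2) := by positivity
  have h4 := h.trans (mul_le_mul_of_nonneg_left h2 h3)
  simp only [← hc, sub_self, zero_div, Real.exp_zero, one_mul] at h4
  rw [cylinderConst]
  linarith

end Solutions

/-! ### The periodized density -/

section Periodized

variable {φ : ℝ → ℝ} {f : ℝ} {ρ : ℝ → ℝ → ℝ}

/-- The windows `[j - 2, j + 3]` cover the line five times. -/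
lemma hasSum_integral_window {g : ℝ → ℝ} (h : ∫ x, g x = 1) :
    HasSum (fun j : ℤ => ∫ x in ((j : ℝ) - 2)..(j + 3), g x) 5 := by
  have hg := MeasureTheory.integrable_of_integral_eq_one h
  have h1 := hasSum_sum (s := Finset.range 5) fun i _ =>
    hg.hasSum_intervalIntegral (-2 + (i : ℝ))
  rw [h] at h1
  simp only [Finset.sum_const, Finset.card_range, nsmul_eq_mul, Nat.cast_ofNat, mul_one] at h1
  have h2 (j : ℤ) : ∫ x in ((j : ℝ) - 2)..(j + 3), g x =
      ∑ i ∈ Finset.range 5, ∫ x in (-2 + (i : ℝ) + j)..(-2 + (i : ℝ) + j + 1), g x := by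
    have h := intervalIntegral.sum_integral_adjacent_intervals (f := g) (μ := volume)
      (a := fun k : ℕ => -2 + (k : ℝ) + j) (n := 5) fun k _ => hg.intervalIntegrable
    have h3 (i : ℕ) : -2 + ((i + 1 : ℕ) : ℝ) + j = -2 + (i : ℝ) + j + 1 := by push_cast; ring
    simp only [h3] at h
    rw [h]
    congr 1 <;> (push_cast; ring)
  simpa only [h2] using h1

/-- A summable majorant for the translates of `ρ`, locally uniform in space and time: the mean value
inequality bounds `ρ (j + x) t` by the mass over a fixed window around `j` and a bounded time
interval, and the windows overlap boundedly. -/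
lemma exists_summable_bound (hφ : ContDiff ℝ 2 φ) (hper : Function.Periodic φ 1)
    (hρ : FokkerPlanckDensity φ f ρ) {t₁ t₂ : ℝ} (h₁ : 0 < t₁) (h₁₂ : t₁ ≤ t₂) :
    ∃ a : ℤ → ℝ, Summable a ∧
      ∀ j : ℤ, ∀ x ∈ Icc (-1 : ℝ) 2, ∀ t ∈ Icc t₁ t₂, ρ (j + x) t ≤ a j := by
  obtain ⟨B, hB, hb, hb'⟩ := exists_drift_bound hφ hper f
  have hsol := hρ.solution.isSolution hφ
  set τ : ℝ := min (t₁ / 2) 1 with hτ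
  have hτ0 : 0 < τ := by positivity
  have hτ1 : τ ≤ 1 := min_le_right _ _
  have hτ2 : τ ≤ t₁ / 2 := min_le_left _ _
  have hle : t₁ / 2 ≤ t₂ := by linarith
  have hC := cylinderConst_nonneg B τ
  have hwin (j : ℤ) : (j : ℝ) - 2 ≤ j + 3 := by linarith
  have hcont : ContinuousOn (Function.uncurry ρ) (univ ×ˢ Icc (t₁ / 2) t₂) :=
    hsol.continuousOn.mono (prod_mono_right fun t ht => by
      have := ht.1; simp only [mem_Ioi]; linarith)
  have hpos (t : ℝ) (ht : t ∈ Icc (t₁ / 2) t₂) : 0 < t := by linarith [ht.1]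
  have hmass (j : ℤ) : ContinuousOn (fun t => ∫ x in ((j : ℝ) - 2)..(j + 3), ρ x t)
      (Icc (t₁ / 2) t₂) :=
    continuousOn_integral_rect (hwin j) hle (hcont.mono (prod_mono_left (subset_univ _)))
  have hmass0 (j : ℤ) (t : ℝ) (ht : t ∈ Icc (t₁ / 2) t₂) :
      0 ≤ ∫ x in ((j : ℝ) - 2)..(j + 3), ρ x t :=
    intervalIntegral.integral_nonneg (hwin j) fun x _ => hρ.nonneg x t (hpos t ht)
  refine ⟨fun j => cylinderConst B τ *
    ∫ t in (t₁ / 2)..t₂, ∫ x in ((j : ℝ) - 2)..(j + 3), ρ x t, Summable.mul_left _ ?_, ?_⟩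
  · refine summable_of_sum_le (c := (t₂ - t₁ / 2) * 5)
      (fun j => intervalIntegral.integral_nonneg hle (hmass0 j)) fun s => ?_
    rw [← intervalIntegral.integral_finsetSum fun j _ => (hmass j).intervalIntegrable_Icc hle]
    calc _ ≤ ∫ _ in (t₁ / 2)..t₂, (5 : ℝ) := by
          refine intervalIntegral.integral_mono_on hle
            ((continuousOn_finsetSum s fun j _ => hmass j).intervalIntegrable_Icc hle)
            intervalIntegrable_const fun t ht => ?_
          exact sum_le_hasSum s (fun j _ => hmass0 j t ht)
            (hasSum_integral_window (hρ.integral_eq_one t (hpos t ht)))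
      _ = (t₂ - t₁ / 2) * 5 := by rw [intervalIntegral.integral_const, smul_eq_mul]
  · intro j x hx t ht
    refine (hsol.le_integral hφ hB hb hb' hρ.nonneg (x₀ := j + x) (t₀ := t) hτ0 hτ1
      (by linarith [ht.1])).trans (mul_le_mul_of_nonneg_left ?_ hC)
    have hsub : Icc (t - τ) t ⊆ Icc (t₁ / 2) t₂ :=
      Icc_subset_Icc (by linarith [ht.1]) ht.2
    have hτt : t - τ ≤ t := by linarith
    have hx2 : (j : ℝ) + x - 1 ≤ j + x + 1 := by linarith
    calc _ ≤ ∫ s in (t - τ)..t, ∫ y in ((j : ℝ) - 2)..(j + 3), ρ y s := by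
          refine intervalIntegral.integral_mono_on hτt
            ((continuousOn_integral_rect hx2 hτt (hcont.mono
              (prod_mono (subset_univ _) hsub))).intervalIntegrable_Icc hτt)
            (((hmass j).mono hsub).intervalIntegrable_Icc hτt) fun s hs => ?_
          refine intervalIntegral.integral_mono_interval (by linarith [hx.1]) hx2
            (by linarith [hx.2])
            (Eventually.of_forall fun y => hρ.nonneg y s (hpos s (hsub hs)))
            (((hcont.rect_left (hsub hs)).mono (subset_univ _)).intervalIntegrable_Icc (hwin j))
      _ ≤ _ := by
          refine intervalIntegral.integral_mono_interval (hsub ⟨le_rfl, hτt⟩).1 hτt ht.2 ?_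
            ((hmass j).intervalIntegrable_Icc hle)
          rw [EventuallyLE, ae_restrict_iff' measurableSet_Ioc]
          exact Eventually.of_forall fun s hs => hmass0 j s ⟨hs.1.le, hs.2⟩

lemma periodic_periodized (ρ : ℝ → ℝ → ℝ) (t : ℝ) :
    Function.Periodic (fun x => periodized ρ x t) 1 := by
  intro x
  simp only [periodized]
  refine Eq.trans ?_ ((Equiv.addRight (1 : ℤ)).tsum_eq fun j : ℤ => ρ (j + x) t)
  refine tsum_congr fun j => ?_
  congr 1
  simp only [Equiv.coe_addRight]
  push_cast
  ring

lemma norm_translate_le (hρ : FokkerPlanckDensity φ f ρ) {a : ℤ → ℝ} {t₁ t₂ : ℝ} (h₁ : 0 < t₁)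
    (ha : ∀ j : ℤ, ∀ x ∈ Icc (-1 : ℝ) 2, ∀ t ∈ Icc t₁ t₂, ρ (j + x) t ≤ a j) (j : ℤ) {x t : ℝ}
    (hx : x ∈ Icc (-1 : ℝ) 2) (ht : t ∈ Icc t₁ t₂) : ‖ρ (j + x) t‖ ≤ a j := by
  rw [Real.norm_of_nonneg (hρ.nonneg _ t (h₁.trans_le ht.1))]
  exact ha j x hx t ht

lemma summable_translates_of_mem (hφ : ContDiff ℝ 2 φ) (hper : Function.Periodic φ 1)
    (hρ : FokkerPlanckDensity φ f ρ) {x : ℝ} (hx : x ∈ Icc (-1 : ℝ) 2) {t : ℝ} (ht : 0 < t) :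
    Summable fun j : ℤ => ρ (j + x) t := by
  obtain ⟨a, hsum, ha⟩ := exists_summable_bound hφ hper hρ ht le_rfl
  exact hsum.of_norm_bounded fun j => norm_translate_le hρ ht ha j hx ⟨le_rfl, le_rfl⟩

lemma summable_translates (hφ : ContDiff ℝ 2 φ) (hper : Function.Periodic φ 1)
    (hρ : FokkerPlanckDensity φ f ρ) (x : ℝ) {t : ℝ} (ht : 0 < t) :
    Summable fun j : ℤ => ρ (j + x) t := by
  have hfr : Int.fract x ∈ Icc (-1 : ℝ) 2 :=
    ⟨by linarith [Int.fract_nonneg x], by linarith [Int.fract_lt_one x]⟩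
  have h := summable_translates_of_mem hφ hper hρ hfr ht
  rw [← (Equiv.addRight ⌊x⌋).summable_iff] at h
  refine h.congr fun j => ?_
  simp only [Function.comp, Equiv.coe_addRight]
  congr 1
  push_cast
  linarith [Int.floor_add_fract x]

lemma continuousOn_periodized (hφ : ContDiff ℝ 2 φ) (hper : Function.Periodic φ 1)
    (hρ : FokkerPlanckDensity φ f ρ) {t₁ t₂ : ℝ} (h₁ : 0 < t₁) (h₁₂ : t₁ ≤ t₂) :
    ContinuousOn (Function.uncurry (periodized ρ)) (Icc (-1) 2 ×ˢ Icc t₁ t₂) := by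
  obtain ⟨a, hsum, ha⟩ := exists_summable_bound hφ hper hρ h₁ h₁₂
  have hsol := hρ.solution.isSolution hφ
  exact continuousOn_tsum (f := fun (j : ℤ) (q : ℝ × ℝ) => ρ (j + q.1) q.2)
    (fun j => (hsol.translate hper j).continuousOn.mono (prod_mono (subset_univ _)
      fun t ht => h₁.trans_le ht.1)) hsum
    fun j q hq => norm_translate_le hρ h₁ ha j hq.1 hq.2

/-- Termwise integration of a series of continuous functions with a summable bound. -/
lemma hasSum_integral_of_bound {ι : Type*} [Countable ι] {g : ι → ℝ → ℝ} {u : ι → ℝ} {a b : ℝ}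
    (hab : a ≤ b) (hu : Summable u) (hg : ∀ i, ContinuousOn (g i) (Icc a b))
    (hbd : ∀ i, ∀ x ∈ Icc a b, ‖g i x‖ ≤ u i) :
    HasSum (fun i => ∫ x in a..b, g i x) (∫ x in a..b, ∑' i, g i x) := by
  have hI : ∀ x ∈ uIoc a b, x ∈ Icc a b := fun x hx => by
    rw [uIoc_of_le hab] at hx; exact ⟨hx.1.le, hx.2⟩
  refine intervalIntegral.hasSum_integral_of_dominated_convergence (fun i _ => u i)
    (fun i => ?_) (fun i => Eventually.of_forall fun x hx => hbd i x (hI x hx))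
    (Eventually.of_forall fun _ _ => hu) intervalIntegrable_const
    (Eventually.of_forall fun x hx => ?_)
  · rw [uIoc_of_le hab]
    exact ((hg i).mono Ioc_subset_Icc_self).aestronglyMeasurable measurableSet_Ioc
  · exact (hu.of_norm_bounded fun i => hbd i x (hI x hx)).hasSum

lemma integral_periodized (hφ : ContDiff ℝ 2 φ) (hper : Function.Periodic φ 1)
    (hρ : FokkerPlanckDensity φ f ρ) {t : ℝ} (ht : 0 < t) :
    ∫ x in (0 : ℝ)..1, periodized ρ x t = 1 := by
  obtain ⟨a, hsum, ha⟩ := exists_summable_bound hφ hper hρ ht le_rfl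
  have hsol := hρ.solution.isSolution hφ
  have htm : t ∈ Icc t t := ⟨le_rfl, le_rfl⟩
  have h1 := hasSum_integral_of_bound (g := fun (j : ℤ) x => ρ (j + x) t) zero_le_one hsum
    (fun j => ((hsol.translate hper j).continuousOn.rect_left (mem_Ioi.2 ht)).mono (subset_univ _))
    (fun j x hx => norm_translate_le hρ ht ha j ⟨by linarith [hx.1], by linarith [hx.2]⟩ htm)
  have hint := MeasureTheory.integrable_of_integral_eq_one (hρ.integral_eq_one t ht)
  have h2 := hint.hasSum_intervalIntegral 0
  rw [hρ.integral_eq_one t ht] at h2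
  have h3 (j : ℤ) : ∫ x in (0 + (j : ℝ))..(0 + j + 1), ρ x t =
      ∫ x in (0 : ℝ)..1, ρ (j + x) t := by
    rw [intervalIntegral.integral_comp_add_left (fun x => ρ x t) (j : ℝ)]
    congr 1 <;> ring
  simp only [h3] at h2
  exact h1.unique h2

/-! ### Time averages -/

/-- Differentiation under the integral sign over a compact interval. -/
lemma hasDerivAt_integral_param {F Fx : ℝ → ℝ → ℝ} {a b : ℝ} (hab : a ≤ b)
    (hF : ContinuousOn (Function.uncurry F) (univ ×ˢ Icc a b))
    (hFx : ContinuousOn (Function.uncurry Fx) (univ ×ˢ Icc a b))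
    (hd : ∀ x, ∀ s ∈ Icc a b, HasDerivAt (fun x => F x s) (Fx x s) x) (x : ℝ) :
    HasDerivAt (fun x => ∫ s in a..b, F x s) (∫ s in a..b, Fx x s) x := by
  have hI : ∀ s ∈ uIoc a b, s ∈ Icc a b := fun s hs => by
    rw [uIoc_of_le hab] at hs; exact ⟨hs.1.le, hs.2⟩
  obtain ⟨C, hC⟩ := (isCompact_Icc.prod isCompact_Icc).exists_bound_of_continuousOn
    (hFx.mono (prod_mono_left (subset_univ (Icc (x - 1) (x + 1)))))
  have hmeas {k : ℝ → ℝ → ℝ} (hk : ContinuousOn (Function.uncurry k) (univ ×ˢ Icc a b)) (y : ℝ) :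
      AEStronglyMeasurable (k y) (volume.restrict (uIoc a b)) := by
    rw [uIoc_of_le hab]
    exact ((hk.rect_right (mem_univ y)).mono Ioc_subset_Icc_self).aestronglyMeasurable
      measurableSet_Ioc
  exact (intervalIntegral.hasDerivAt_integral_of_dominated_loc_of_deriv_le
    (bound := fun _ => C) (Icc_mem_nhds (by linarith) (by linarith) : Icc (x - 1) (x + 1) ∈ 𝓝 x)
    (Eventually.of_forall (hmeas hF))
    ((hF.rect_right (mem_univ x)).intervalIntegrable_Icc hab) (hmeas hFx x)
    (Eventually.of_forall fun s hs y hy => hC (y, s) ⟨hy, hI s hs⟩) intervalIntegrable_const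
    (Eventually.of_forall fun s hs y _ => hd y s (hI s hs))).2

section TimeIntegral

variable {v vx vxx vt : ℝ → ℝ → ℝ} {t₁ t₂ : ℝ}

lemma IsSolution.hasDerivAt_timeIntegral (hφ : ContDiff ℝ 2 φ) (hv : IsSolution φ f v vx vxx vt)
    (h₁ : 0 < t₁) (h₁₂ : t₁ ≤ t₂) (x : ℝ) :
    HasDerivAt (fun x => ∫ s in t₁..t₂, v x s)
      ((∫ s in t₁..t₂, ((deriv φ x - f) * v x s + vx x s)) -
        (deriv φ x - f) * ∫ s in t₁..t₂, v x s) x ∧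
    HasDerivAt (fun x => ∫ s in t₁..t₂, ((deriv φ x - f) * v x s + vx x s))
      (v x t₂ - v x t₁) x := by
  have hsub : univ ×ˢ Icc t₁ t₂ ⊆ (univ : Set ℝ) ×ˢ Ioi (0 : ℝ) :=
    prod_mono_right fun t ht => h₁.trans_le ht.1
  have hpos (s : ℝ) (hs : s ∈ Icc t₁ t₂) : 0 < s := h₁.trans_le hs.1
  have hcv := hv.continuousOn.mono hsub
  have hcx := hv.continuousOn_x.mono hsub
  have hct := hv.continuousOn_t.mono hsub
  have hcd := continuous_deriv_potential hφ
  have hi1 := (hcv.rect_right (mem_univ x)).intervalIntegrable_Icc h₁₂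
  have hi2 := (hcx.rect_right (mem_univ x)).intervalIntegrable_Icc h₁₂
  constructor
  · refine (hasDerivAt_integral_param h₁₂ hcv hcx
      (fun y s hs => hv.hasDerivAt_x y s (hpos s hs)) x).congr_deriv ?_
    rw [intervalIntegral.integral_add (hi1.const_mul _) hi2, intervalIntegral.integral_const_mul]
    ring
  · have hdrift : Continuous fun q : ℝ × ℝ => deriv φ q.1 - f := by fun_prop
    refine (hasDerivAt_integral_param h₁₂
      (F := fun x s => (deriv φ x - f) * v x s + vx x s)
      ((hdrift.continuousOn.mul hcv).add hcx) hct (fun y s hs => ?_) x).congr_deriv ?_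
    · refine ((((hasDerivAt_deriv_potential hφ y).sub_const f).mul
        (hv.hasDerivAt_x y s (hpos s hs))).add (hv.hasDerivAt_xx y s (hpos s hs))).congr_deriv ?_
      rw [hv.equation y s (hpos s hs)]
    · refine intervalIntegral.integral_eq_sub_of_hasDerivAt (fun s hs => ?_)
        ((hct.rect_right (mem_univ x)).intervalIntegrable_Icc h₁₂)
      rw [uIcc_of_le h₁₂] at hs
      exact hv.hasDerivAt_t x s (hpos s hs)

/-- The time integral of the flux is bounded in terms of the solution alone: by the mean value
theorem this holds at some point, and the derivative in space is `v x t₂ - v x t₁`. -/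
lemma IsSolution.abs_timeIntegral_flux_le (hφ : ContDiff ℝ 2 φ) {B : ℝ} (hB : 0 ≤ B)
    (hb : ∀ x, |deriv φ x - f| ≤ B) (hv : IsSolution φ f v vx vxx vt) (h₁ : 0 < t₁)
    (h₁₂ : t₁ ≤ t₂) {a : ℝ} (h0 : ∀ x ∈ Icc (-1 : ℝ) 2, ∀ t ∈ Icc t₁ t₂, 0 ≤ v x t)
    (ha : ∀ x ∈ Icc (-1 : ℝ) 2, ∀ t ∈ Icc t₁ t₂, v x t ≤ a) {x : ℝ} (hx : x ∈ Icc (-1 : ℝ) 2) :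
    |∫ s in t₁..t₂, ((deriv φ x - f) * v x s + vx x s)| ≤ ((1 + B) * (t₂ - t₁) + 3) * a := by
  set S : ℝ → ℝ := fun x => ∫ s in t₁..t₂, v x s with hS
  set P : ℝ → ℝ := fun x => ∫ s in t₁..t₂, ((deriv φ x - f) * v x s + vx x s) with hP
  have hd := hv.hasDerivAt_timeIntegral hφ h₁ h₁₂
  have hcv : ContinuousOn (Function.uncurry v) (univ ×ˢ Icc t₁ t₂) :=
    hv.continuousOn.mono (prod_mono_right fun t ht => h₁.trans_le ht.1)
  have hS0 (y : ℝ) (hy : y ∈ Icc (-1 : ℝ) 2) : 0 ≤ S y :=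
    intervalIntegral.integral_nonneg h₁₂ fun s hs => h0 y hy s hs
  have hSa (y : ℝ) (hy : y ∈ Icc (-1 : ℝ) 2) : S y ≤ (t₂ - t₁) * a := by
    calc S y ≤ ∫ _ in t₁..t₂, a := intervalIntegral.integral_mono_on h₁₂
          ((hcv.rect_right (mem_univ y)).intervalIntegrable_Icc h₁₂) intervalIntegrable_const
          fun s hs => ha y hy s hs
      _ = (t₂ - t₁) * a := by rw [intervalIntegral.integral_const, smul_eq_mul]
  have h0m : (0 : ℝ) ∈ Icc (-1 : ℝ) 2 := by constructor <;> norm_num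
  have h1m : (1 : ℝ) ∈ Icc (-1 : ℝ) 2 := by constructor <;> norm_num
  obtain ⟨x₁, hx₁, hslope⟩ := exists_hasDerivAt_eq_slope S
    (fun x => P x - (deriv φ x - f) * S x) zero_lt_one
    (fun y _ => (hd y).1.continuousAt.continuousWithinAt) fun y _ => (hd y).1
  have hx₁m : x₁ ∈ Icc (-1 : ℝ) 2 := ⟨by linarith [hx₁.1], by linarith [hx₁.2]⟩
  have ha0 : 0 ≤ a := (h0 x hx t₁ ⟨le_rfl, h₁₂⟩).trans (ha x hx t₁ ⟨le_rfl, h₁₂⟩)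
  have hPx₁ : |P x₁| ≤ (1 + B) * (t₂ - t₁) * a := by
    have e : P x₁ = (S 1 - S 0) + (deriv φ x₁ - f) * S x₁ := by
      simp only [sub_zero, div_one] at hslope
      linarith
    have e1 : |S 1 - S 0| ≤ (t₂ - t₁) * a := abs_le.2
      ⟨by linarith [hS0 1 h1m, hSa 0 h0m], by linarith [hS0 0 h0m, hSa 1 h1m]⟩
    have e2 : |(deriv φ x₁ - f) * S x₁| ≤ B * ((t₂ - t₁) * a) := by
      rw [abs_mul, abs_of_nonneg (hS0 x₁ hx₁m)]
      exact mul_le_mul (hb x₁) (hSa x₁ hx₁m) (hS0 x₁ hx₁m) hB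
    rw [e]
    refine (abs_add_le _ _).trans ?_
    linarith
  have hlip := Convex.norm_image_sub_le_of_norm_hasDerivWithin_le (f := P)
    (f' := fun x => v x t₂ - v x t₁) (s := Icc (-1 : ℝ) 2) (C := a)
    (fun y _ => (hd y).2.hasDerivWithinAt) (fun y hy => by
      have := h0 y hy t₁ ⟨le_rfl, h₁₂⟩
      have := h0 y hy t₂ ⟨h₁₂, le_rfl⟩
      have := ha y hy t₁ ⟨le_rfl, h₁₂⟩
      have := ha y hy t₂ ⟨h₁₂, le_rfl⟩
      rw [Real.norm_eq_abs]
      exact abs_le.2 ⟨by linarith, by linarith⟩) (convex_Icc _ _) hx₁m hx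
  have hdist : ‖x - x₁‖ ≤ 3 := by
    rw [Real.norm_eq_abs]
    exact abs_le.2 ⟨by linarith [hx.1, hx₁m.2], by linarith [hx.2, hx₁m.1]⟩
  have h3 : |P x - P x₁| ≤ a * 3 := hlip.trans (mul_le_mul_of_nonneg_left hdist ha0)
  have h4 : |P x| ≤ |P x - P x₁| + |P x₁| := by
    have := abs_add_le (P x - P x₁) (P x₁)
    rwa [sub_add_cancel] at this
  linarith

end TimeIntegral

/-- A periodic function with mean one over a period that solves the Fokker–Planck equation after
integration in time: its time integrals are differentiable, and they have a flux
`P` whose derivative is the increment of `R`. No derivative of `R` itself is required. -/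
structure PeriodicTimeIntegralSolution (φ : ℝ → ℝ) (f : ℝ) (R : ℝ → ℝ → ℝ) : Prop where
  periodic : ∀ t, Function.Periodic (fun x => R x t) 1
  continuousOn : ∀ t₁ t₂, 0 < t₁ → t₁ ≤ t₂ →
    ContinuousOn (Function.uncurry R) (Icc (-1) 2 ×ˢ Icc t₁ t₂)
  integral_eq_one : ∀ t > 0, ∫ x in (0 : ℝ)..1, R x t = 1
  exists_flux : ∀ t₁ t₂, 0 < t₁ → t₁ ≤ t₂ → ∃ P : ℝ → ℝ, ∀ x ∈ Ioo (-1 : ℝ) 2,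
    HasDerivAt (fun x => ∫ s in t₁..t₂, R x s)
      (P x - (deriv φ x - f) * ∫ s in t₁..t₂, R x s) x ∧
    HasDerivAt P (R x t₂ - R x t₁) x

lemma exists_flux_periodized (hφ : ContDiff ℝ 2 φ) (hper : Function.Periodic φ 1)
    (hρ : FokkerPlanckDensity φ f ρ) {t₁ t₂ : ℝ} (h₁ : 0 < t₁) (h₁₂ : t₁ ≤ t₂) :
    ∃ P : ℝ → ℝ, ∀ x ∈ Ioo (-1 : ℝ) 2,
      HasDerivAt (fun x => ∫ s in t₁..t₂, periodized ρ x s)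
        (P x - (deriv φ x - f) * ∫ s in t₁..t₂, periodized ρ x s) x ∧
      HasDerivAt P (periodized ρ x t₂ - periodized ρ x t₁) x := by
  obtain ⟨B, hB, hb, -⟩ := exists_drift_bound hφ hper f
  obtain ⟨a, hsum, ha⟩ := exists_summable_bound hφ hper hρ h₁ h₁₂
  have hsol (j : ℤ) := (hρ.solution.isSolution hφ).translate hper j
  have hpos (s : ℝ) (hs : s ∈ Icc t₁ t₂) : 0 < s := h₁.trans_le hs.1
  have hm₁ : t₁ ∈ Icc t₁ t₂ := ⟨le_rfl, h₁₂⟩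
  have hm₂ : t₂ ∈ Icc t₁ t₂ := ⟨h₁₂, le_rfl⟩
  set S : ℤ → ℝ → ℝ := fun j x => ∫ s in t₁..t₂, ρ (j + x) s with hS
  set P : ℤ → ℝ → ℝ := fun j x => ∫ s in t₁..t₂, ((deriv φ x - f) * ρ (j + x) s +
    deriv (fun y => ρ y s) (j + x)) with hP
  have hd (j : ℤ) (x : ℝ) : HasDerivAt (S j) (P j x - (deriv φ x - f) * S j x) x ∧
      HasDerivAt (P j) (ρ (j + x) t₂ - ρ (j + x) t₁) x :=
    (hsol j).hasDerivAt_timeIntegral hφ h₁ h₁₂ x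
  have ha0 (j : ℤ) : 0 ≤ a j :=
    (hρ.nonneg _ t₁ h₁).trans (ha j 0 (by constructor <;> norm_num) t₁ hm₁)
  have hSsum (x : ℝ) (hx : x ∈ Icc (-1 : ℝ) 2) :
      HasSum (fun j => S j x) (∫ s in t₁..t₂, periodized ρ x s) :=
    hasSum_integral_of_bound h₁₂ hsum
      (fun j => ((hsol j).continuousOn.rect_right (mem_univ x)).mono hpos)
      fun j s hs => norm_translate_le hρ h₁ ha j hx hs
  have hSb (j : ℤ) (x : ℝ) (hx : x ∈ Icc (-1 : ℝ) 2) : |S j x| ≤ (t₂ - t₁) * a j := by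
    have := intervalIntegral.norm_integral_le_of_norm_le_const (a := t₁) (b := t₂) (C := a j)
      (f := fun s => ρ (j + x) s) fun s hs => by
        rw [uIoc_of_le h₁₂] at hs
        exact norm_translate_le hρ h₁ ha j hx ⟨hs.1.le, hs.2⟩
    rw [abs_of_nonneg (sub_nonneg.2 h₁₂)] at this
    rw [mul_comm]
    exact this
  have hPb (j : ℤ) (x : ℝ) (hx : x ∈ Icc (-1 : ℝ) 2) :
      |P j x| ≤ ((1 + B) * (t₂ - t₁) + 3) * a j :=
    (hsol j).abs_timeIntegral_flux_le hφ hB hb h₁ h₁₂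
      (fun y _ t ht => hρ.nonneg _ t (hpos t ht)) (fun y hy t ht => ha j y hy t ht) hx
  have hPsum (x : ℝ) (hx : x ∈ Icc (-1 : ℝ) 2) : Summable fun j => P j x :=
    (hsum.mul_left ((1 + B) * (t₂ - t₁) + 3)).of_norm_bounded fun j => hPb j x hx
  have hIoo (x : ℝ) (hx : x ∈ Ioo (-1 : ℝ) 2) : x ∈ Icc (-1 : ℝ) 2 := Ioo_subset_Icc_self hx
  have h0m : (0 : ℝ) ∈ Ioo (-1 : ℝ) 2 := by constructor <;> norm_num
  refine ⟨fun x => ∑' j, P j x, fun x hx => ⟨?_, ?_⟩⟩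
  · have h := hasDerivAt_tsum_of_isPreconnected
      (u := fun j => ((1 + B) * (t₂ - t₁) + 3) * a j + B * ((t₂ - t₁) * a j))
      ((hsum.mul_left _).add ((hsum.mul_left _).mul_left _)) isOpen_Ioo isPreconnected_Ioo
      (fun j y _ => (hd j y).1) (fun j y hy => ?_) h0m (hSsum 0 (hIoo 0 h0m)).summable hx
    · refine (h.congr_of_eventuallyEq ?_).congr_deriv ?_
      · filter_upwards [Ioo_mem_nhds hx.1 hx.2] with y hy
        exact (hSsum y (hIoo y hy)).tsum_eq.symm
      · rw [(hPsum x (hIoo x hx)).tsum_sub ((hSsum x (hIoo x hx)).summable.mul_left _),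
          tsum_mul_left, (hSsum x (hIoo x hx)).tsum_eq]
    · refine (norm_sub_le _ _).trans (add_le_add (hPb j y (hIoo y hy)) ?_)
      rw [norm_mul]
      exact mul_le_mul (hb y) (hSb j y (hIoo y hy)) (abs_nonneg _) hB
  · have h := hasDerivAt_tsum_of_isPreconnected (u := fun j => a j + a j) (hsum.add hsum)
      isOpen_Ioo isPreconnected_Ioo (fun j y _ => (hd j y).2) (fun j y hy => ?_) h0m
      (hPsum 0 (hIoo 0 h0m)) hx
    · refine h.congr_deriv ?_
      have hs (t : ℝ) (ht : 0 < t) := summable_translates_of_mem hφ hper hρ (hIoo x hx) ht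
      exact (hs t₂ (hpos t₂ hm₂)).tsum_sub (hs t₁ h₁)
    · exact (norm_sub_le _ _).trans (add_le_add (norm_translate_le hρ h₁ ha j (hIoo y hy) hm₂)
        (norm_translate_le hρ h₁ ha j (hIoo y hy) hm₁))

lemma FokkerPlanckDensity.periodized (hφ : ContDiff ℝ 2 φ) (hper : Function.Periodic φ 1)
    (hρ : FokkerPlanckDensity φ f ρ) : PeriodicTimeIntegralSolution φ f (periodized ρ) :=
  ⟨periodic_periodized ρ, fun _ _ h₁ h₁₂ => continuousOn_periodized hφ hper hρ h₁ h₁₂,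
    fun _ ht => integral_periodized hφ hper hρ ht,
    fun _ _ h₁ h₁₂ => exists_flux_periodized hφ hper hρ h₁ h₁₂⟩

end Periodized

/-! ### Decay of the weighted energy -/

/-- A Poincaré inequality in sup norm: the square of a function with a zero in `[0, 1]` is at most
the integral of the square of its derivative. -/
lemma sq_le_integral_sq_deriv {H G : ℝ → ℝ} (hH : ∀ x ∈ Icc (0 : ℝ) 1, HasDerivAt H (G x) x)
    (hG : ContinuousOn G (Icc 0 1)) {x₁ : ℝ} (hx₁ : x₁ ∈ Icc (0 : ℝ) 1) (h0 : H x₁ = 0) {x : ℝ}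
    (hx : x ∈ Icc (0 : ℝ) 1) : H x ^ 2 ≤ ∫ y in (0 : ℝ)..1, G y ^ 2 := by
  set l : ℝ := ∫ y in (0 : ℝ)..1, |G y| with hl
  have hsub : uIcc x₁ x ⊆ Icc 0 1 := uIcc_subset_Icc hx₁ hx
  have hGabs : IntervalIntegrable (fun y => |G y|) volume 0 1 :=
    hG.abs.intervalIntegrable_Icc zero_le_one
  have hGsq : IntervalIntegrable (fun y => G y ^ 2) volume 0 1 :=
    (hG.fun_pow 2).intervalIntegrable_Icc zero_le_one
  have hle : |H x| ≤ l := by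
    have hftc := intervalIntegral.integral_eq_sub_of_hasDerivAt (fun y hy => hH y (hsub hy))
      ((hG.mono hsub).intervalIntegrable)
    rw [h0, sub_zero] at hftc
    rw [← hftc, ← Real.norm_eq_abs]
    refine (intervalIntegral.norm_integral_le_abs_integral_norm (μ := volume)).trans ?_
    simp only [Real.norm_eq_abs]
    rw [hl, ← abs_of_nonneg (intervalIntegral.integral_nonneg zero_le_one
      fun y _ => abs_nonneg (G y) : (0 : ℝ) ≤ ∫ y in (0 : ℝ)..1, |G y|)]
    refine intervalIntegral.abs_integral_mono_interval ?_
      (Eventually.of_forall fun y => abs_nonneg _) hGabs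
    rw [uIoc_of_le zero_le_one]
    exact Ioc_subset_Ioc (le_min hx₁.1 hx.1) (max_le hx₁.2 hx.2)
  -- the variance of `|G|` is nonnegative
  have hvar : 0 ≤ ∫ y in (0 : ℝ)..1, (G y ^ 2 - 2 * l * |G y| + l ^ 2) := by
    refine intervalIntegral.integral_nonneg zero_le_one fun y _ => ?_
    have := sq_nonneg (|G y| - l)
    have := sq_abs (G y)
    linarith
  rw [intervalIntegral.integral_add (hGsq.sub (hGabs.const_mul _)) intervalIntegrable_const,
    intervalIntegral.integral_sub hGsq (hGabs.const_mul _), intervalIntegral.integral_const_mul,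
    intervalIntegral.integral_const, ← hl, smul_eq_mul] at hvar
  have : H x ^ 2 ≤ l ^ 2 := by
    rw [← sq_abs (H x)]
    gcongr
  linarith

/-- The energy inequality at a fixed time. Here `u` has constant flux `c`, the flux of `V` is `P`,
and `V - u = u H`. The flux of `V - u` is `P - c = u H' + c H`, so integrating `H P'` by parts
leaves `-∫ u H'²`; the term with `c` is a total derivative. -/
lemma energy_slice_le {b u V P D : ℝ → ℝ} {c m : ℝ} (hm : 0 < m)
    (hu : ∀ x ∈ Icc (0 : ℝ) 1, HasDerivAt u (c - b x * u x) x)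
    (hmu : ∀ x ∈ Icc (0 : ℝ) 1, m ≤ u x)
    (hV : ∀ x ∈ Icc (0 : ℝ) 1, HasDerivAt V (P x - b x * V x) x)
    (hP : ∀ x ∈ Icc (0 : ℝ) 1, HasDerivAt P (D x) x) (hD : ContinuousOn D (Icc 0 1))
    (hu1 : u 1 = u 0) (hV1 : V 1 = V 0) (hP1 : P 1 = P 0)
    (hui : ∫ x in (0 : ℝ)..1, u x = 1) (hVi : ∫ x in (0 : ℝ)..1, V x = 1) :
    m * ∫ x in (0 : ℝ)..1, (V x - u x) ^ 2 / u x ≤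
      -∫ x in (0 : ℝ)..1, (V x - u x) / u x * D x := by
  have h01 : (0 : ℝ) ≤ 1 := zero_le_one
  have hupos (x : ℝ) (hx : x ∈ Icc (0 : ℝ) 1) : 0 < u x := hm.trans_le (hmu x hx)
  set H : ℝ → ℝ := fun x => (V x - u x) / u x with hHdef
  set G : ℝ → ℝ := fun x => (P x - c - c * H x) / u x with hGdef
  have hH (x : ℝ) (hx : x ∈ Icc (0 : ℝ) 1) : HasDerivAt H (G x) x := by
    have hne := (hupos x hx).ne'
    refine (((hV x hx).sub (hu x hx)).div (hu x hx) hne).congr_deriv ?_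
    simp only [hGdef, hHdef, Pi.sub_apply]
    field_simp
    ring
  have hcu : ContinuousOn u (Icc 0 1) := fun x hx => (hu x hx).continuousAt.continuousWithinAt
  have hcV : ContinuousOn V (Icc 0 1) := fun x hx => (hV x hx).continuousAt.continuousWithinAt
  have hcP : ContinuousOn P (Icc 0 1) := fun x hx => (hP x hx).continuousAt.continuousWithinAt
  have hcH : ContinuousOn H (Icc 0 1) := fun x hx => (hH x hx).continuousAt.continuousWithinAt
  have hcG : ContinuousOn G (Icc 0 1) :=
    ((hcP.sub continuousOn_const).sub (hcH.const_mul c)).div hcu fun x hx => (hupos x hx).ne'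
  have hcHD : ContinuousOn (fun x => H x * D x) (Icc 0 1) := hcH.mul hD
  have hcuG : ContinuousOn (fun x => u x * G x ^ 2) (Icc 0 1) := hcu.mul (hcG.pow 2)
  have hparts : ∫ x in (0 : ℝ)..1, (H x * D x + u x * G x ^ 2) = 0 := by
    rw [intervalIntegral.integral_eq_sub_of_hasDerivAt
      (f := fun x => H x * (P x - c) - c * H x ^ 2 / 2)]
    · simp only [hHdef, hu1, hV1, hP1, sub_self]
    · intro x hx
      rw [uIcc_of_le h01] at hx
      refine (((hH x hx).mul ((hP x hx).sub_const c)).sub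
        ((((hH x hx).pow 2).const_mul c).div_const 2)).congr_deriv ?_
      have hPc : P x - c = u x * G x + c * H x := by
        have := (hupos x hx).ne'
        simp only [hGdef]
        field_simp
        ring
      rw [hPc]
      norm_num
      ring
    · exact (hcHD.add hcuG).intervalIntegrable_Icc h01
  rw [intervalIntegral.integral_add (hcHD.intervalIntegrable_Icc h01)
    (hcuG.intervalIntegrable_Icc h01)] at hparts
  obtain ⟨x₁, hx₁, hzero⟩ := exists_eq_zero_of_integral_eq_zero (g := fun x => V x - u x)
    (hcV.sub hcu) (by
      rw [intervalIntegral.integral_sub (hcV.intervalIntegrable_Icc h01)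
        (hcu.intervalIntegrable_Icc h01), hui, hVi, sub_self])
  have hHx₁ : H x₁ = 0 := by simp only [hHdef, hzero, zero_div]
  set I : ℝ := ∫ y in (0 : ℝ)..1, G y ^ 2 with hI
  have hcE : ContinuousOn (fun x => (V x - u x) ^ 2 / u x) (Icc 0 1) :=
    ((hcV.sub hcu).pow 2).div hcu fun x hx => (hupos x hx).ne'
  have hE : ∫ x in (0 : ℝ)..1, (V x - u x) ^ 2 / u x ≤ I := by
    calc _ ≤ ∫ x in (0 : ℝ)..1, u x * I := by
          refine intervalIntegral.integral_mono_on h01 (hcE.intervalIntegrable_Icc h01)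
            ((hcu.mul_const I).intervalIntegrable_Icc h01) fun x hx => ?_
          have h1 := sq_le_integral_sq_deriv hH hcG hx₁ hHx₁ hx
          have h2 : (V x - u x) ^ 2 / u x = u x * H x ^ 2 := by
            have := (hupos x hx).ne'
            simp only [hHdef]
            field_simp
          rw [h2]
          exact mul_le_mul_of_nonneg_left h1 (hupos x hx).le
      _ = I := by rw [intervalIntegral.integral_mul_const, hui, one_mul]
  have hmI : m * I ≤ ∫ x in (0 : ℝ)..1, u x * G x ^ 2 := by
    rw [hI, ← intervalIntegral.integral_const_mul]
    exact intervalIntegral.integral_mono_on h01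
      (((hcG.fun_pow 2).const_mul m).intervalIntegrable_Icc h01) (hcuG.intervalIntegrable_Icc h01)
      fun x hx => mul_le_mul_of_nonneg_right (hmu x hx) (sq_nonneg _)
  have := mul_le_mul_of_nonneg_left hE hm.le
  linarith

section Decay

variable {φ : ℝ → ℝ} {f : ℝ} {R : ℝ → ℝ → ℝ}

/-- The average of `R x` over the time interval `[t, t + h]`. -/
noncomputable def timeAverage (R : ℝ → ℝ → ℝ) (h x t : ℝ) : ℝ := h⁻¹ * ∫ s in t..t + h, R x s

lemma mem_Icc_neg_one_two {x : ℝ} (hx : x ∈ Icc (0 : ℝ) 1) : x ∈ Icc (-1 : ℝ) 2 :=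
  ⟨by linarith [hx.1], by linarith [hx.2]⟩

namespace PeriodicTimeIntegralSolution

lemma continuousOn_time (hR : PeriodicTimeIntegralSolution φ f R) {x : ℝ}
    (hx : x ∈ Icc (-1 : ℝ) 2) : ContinuousOn (R x) (Ioi 0) := by
  intro t ht
  have ht0 : (0 : ℝ) < t := ht
  have h := ((hR.continuousOn (t / 2) (2 * t) (by linarith) (by linarith)).rect_right hx)
  exact (h.continuousAt (Icc_mem_nhds (by linarith) (by linarith))).continuousWithinAt

lemma hasDerivAt_primitive (hR : PeriodicTimeIntegralSolution φ f R) {x : ℝ}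
    (hx : x ∈ Icc (-1 : ℝ) 2) {c t : ℝ} (hc : 0 < c) (ht : 0 < t) :
    HasDerivAt (fun t => ∫ s in c..t, R x s) (R x t) t := by
  have hcont := hR.continuousOn_time hx
  refine intervalIntegral.integral_hasDerivAt_right (ContinuousOn.intervalIntegrable
    (hcont.mono fun s hs => ?_)) (hcont.stronglyMeasurableAtFilter isOpen_Ioi t ht)
    (hcont.continuousAt (Ioi_mem_nhds ht))
  exact (lt_min hc ht).trans_le hs.1

lemma hasDerivAt_timeAverage (hR : PeriodicTimeIntegralSolution φ f R) {h x t : ℝ} (hh : 0 < h)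
    (hx : x ∈ Icc (-1 : ℝ) 2) (ht : 0 < t) :
    HasDerivAt (timeAverage R h x) (h⁻¹ * (R x (t + h) - R x t)) t := by
  have h1 := ((hR.hasDerivAt_primitive hx ht (add_pos ht hh)).comp_add_const t h).sub
    (hR.hasDerivAt_primitive hx ht ht)
  have hcont := hR.continuousOn_time hx
  have hint (s : ℝ) (hs : 0 < s) : IntervalIntegrable (R x) volume t s :=
    ContinuousOn.intervalIntegrable (hcont.mono fun y hy => (lt_min ht hs).trans_le hy.1)
  refine (h1.const_mul h⁻¹).congr_of_eventuallyEq ?_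
  filter_upwards [Ioi_mem_nhds ht] with s hs
  simp only [timeAverage, Pi.sub_apply]
  rw [intervalIntegral.integral_interval_sub_left (hint _ (add_pos hs hh)) (hint _ hs)]

lemma tendsto_timeAverage (hR : PeriodicTimeIntegralSolution φ f R) {x t : ℝ}
    (hx : x ∈ Icc (-1 : ℝ) 2) (ht : 0 < t) :
    Tendsto (fun h => timeAverage R h x t) (𝓝[>] 0) (𝓝 (R x t)) := by
  have h1 := (hR.hasDerivAt_primitive hx ht ht).tendsto_slope_zero_right
  simpa [timeAverage] using h1

lemma continuousOn_timeAverage (hR : PeriodicTimeIntegralSolution φ f R) {h t₁ t₂ : ℝ}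
    (hh : 0 < h) (h₁ : 0 < t₁) (h₁₂ : t₁ ≤ t₂) :
    ContinuousOn (Function.uncurry (timeAverage R h)) (Icc (-1) 2 ×ˢ Icc t₁ t₂) := by
  obtain ⟨G, hG, hGR⟩ := exists_continuous_extension_rect (by norm_num : (-1 : ℝ) ≤ 2)
    (show t₁ ≤ t₂ + h by linarith) (hR.continuousOn t₁ (t₂ + h) h₁ (by linarith))
  have hcont : Continuous fun q : ℝ × ℝ => h⁻¹ * ∫ s in (0 : ℝ)..h, G q.1 (q.2 + s) := by
    refine continuous_const.mul
      (intervalIntegral.continuous_parametric_intervalIntegral_of_continuous'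
        (f := fun (q : ℝ × ℝ) s => G q.1 (q.2 + s)) ?_ 0 h)
    exact hG.comp (f := fun p : (ℝ × ℝ) × ℝ => (p.1.1, p.1.2 + p.2)) (by fun_prop)
  refine hcont.continuousOn.congr fun q hq => ?_
  have h2 := intervalIntegral.integral_comp_add_left (a := 0) (b := h) (fun s => R q.1 s) q.2
  rw [add_zero] at h2
  simp only [Function.uncurry, timeAverage]
  rw [← h2]
  congr 1
  refine intervalIntegral.integral_congr fun s hs => ?_
  rw [uIcc_of_le hh.le] at hs
  exact (hGR q.1 hq.1 _ ⟨by linarith [hq.2.1, hs.1], by linarith [hq.2.2, hs.2]⟩).symm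

lemma timeAverage_add_one (hR : PeriodicTimeIntegralSolution φ f R) (h t x : ℝ) :
    timeAverage R h (x + 1) t = timeAverage R h x t := by
  simp only [timeAverage]
  congr 1
  exact intervalIntegral.integral_congr fun s _ => hR.periodic s x

lemma integral_timeAverage (hR : PeriodicTimeIntegralSolution φ f R) {h t : ℝ} (hh : 0 < h)
    (ht : 0 < t) : ∫ x in (0 : ℝ)..1, timeAverage R h x t = 1 := by
  have hth : t ≤ t + h := by linarith
  simp only [timeAverage, intervalIntegral.integral_const_mul]
  rw [integral_swap_rect zero_le_one hth ((hR.continuousOn t (t + h) ht hth).mono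
    (prod_mono_left fun x hx => mem_Icc_neg_one_two hx)),
    intervalIntegral.integral_congr (g := fun _ => (1 : ℝ)) fun s hs => ?_]
  · rw [intervalIntegral.integral_const, smul_eq_mul, mul_one, add_sub_cancel_left,
      inv_mul_cancel₀ hh.ne']
  · rw [uIcc_of_le hth] at hs
    exact hR.integral_eq_one s (ht.trans_le hs.1)

lemma timeAverage_energy_slice (hφ : ContDiff ℝ 2 φ) (hper : Function.Periodic φ 1)
    (hR : PeriodicTimeIntegralSolution φ f R) {h t m : ℝ} (hh : 0 < h) (ht : 0 < t) (hm : 0 < m)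
    (hmu : ∀ x ∈ Icc (0 : ℝ) 1, m ≤ u₀ φ f x) :
    m * ∫ x in (0 : ℝ)..1, (timeAverage R h x t - u₀ φ f x) ^ 2 / u₀ φ f x ≤
      -∫ x in (0 : ℝ)..1, (timeAverage R h x t - u₀ φ f x) / u₀ φ f x *
        (h⁻¹ * (R x (t + h) - R x t)) := by
  have hth : t ≤ t + h := by linarith
  obtain ⟨P, hP⟩ := hR.exists_flux t (t + h) ht hth
  have hIoo (x : ℝ) (hx : x ∈ Icc (0 : ℝ) 1) : x ∈ Ioo (-1 : ℝ) 2 :=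
    ⟨by linarith [hx.1], by linarith [hx.2]⟩
  have hV (x : ℝ) (hx : x ∈ Icc (0 : ℝ) 1) : HasDerivAt (fun x => timeAverage R h x t)
      (h⁻¹ * P x - (deriv φ x - f) * timeAverage R h x t) x := by
    refine ((hP x (hIoo x hx)).1.const_mul h⁻¹).congr_deriv ?_
    simp only [timeAverage]; ring
  have hcR := hR.continuousOn t (t + h) ht hth
  have hD : ContinuousOn (fun x => h⁻¹ * (R x (t + h) - R x t)) (Icc 0 1) :=
    (((hcR.rect_left ⟨hth, le_rfl⟩).sub (hcR.rect_left ⟨le_rfl, hth⟩)).const_mul h⁻¹).mono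
      fun x hx => mem_Icc_neg_one_two hx
  have h0 : (0 : ℝ) ∈ Icc (0 : ℝ) 1 := ⟨le_rfl, zero_le_one⟩
  have h1 : (1 : ℝ) ∈ Icc (0 : ℝ) 1 := ⟨zero_le_one, le_rfl⟩
  have hV1 : timeAverage R h 1 t = timeAverage R h 0 t := by
    simpa using hR.timeAverage_add_one h t 0
  have hφ1 : deriv φ 1 = deriv φ 0 := by simpa using periodic_deriv hper 0
  -- the derivatives of a periodic function at `0` and at `1` agree
  have hP1 : h⁻¹ * P 1 = h⁻¹ * P 0 := by
    have hd1 := hV 1 h1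
    rw [show (1 : ℝ) = 0 + 1 by norm_num] at hd1
    have hd2 := hd1.comp_add_const 0 1
    simp only [hR.timeAverage_add_one, zero_add] at hd2
    have := hd2.unique (hV 0 h0)
    rw [hφ1, hV1] at this
    linarith
  exact energy_slice_le (b := fun x => deriv φ x - f) (P := fun x => h⁻¹ * P x) hm
    (fun x _ => hasDerivAt_u₀ hφ hper x) hmu hV
    (fun x hx => (hP x (hIoo x hx)).2.const_mul h⁻¹) hD
    (by simpa using periodic_u₀ hper 0) hV1 hP1 (integral_u₀ hφ hper) (hR.integral_timeAverage hh ht)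

/-- Integrated form of `E' ≤ -2 m E` for the weighted energy `E` of a time average. The derivative
of `exp (2 m t) E t` is computed through Fubini's theorem. -/
lemma timeAverage_energy_le (hφ : ContDiff ℝ 2 φ) (hper : Function.Periodic φ 1)
    (hR : PeriodicTimeIntegralSolution φ f R) {h t₁ t₂ m : ℝ} (hh : 0 < h) (h₁ : 0 < t₁)
    (h₁₂ : t₁ ≤ t₂) (hm : 0 < m) (hmu : ∀ x ∈ Icc (0 : ℝ) 1, m ≤ u₀ φ f x) :
    Real.exp (2 * m * t₂) *
        ∫ x in (0 : ℝ)..1, (timeAverage R h x t₂ - u₀ φ f x) ^ 2 / u₀ φ f x ≤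
      Real.exp (2 * m * t₁) *
        ∫ x in (0 : ℝ)..1, (timeAverage R h x t₁ - u₀ φ f x) ^ 2 / u₀ φ f x := by
  set u := u₀ φ f with hu
  set V := timeAverage R h with hVdef
  set D : ℝ → ℝ → ℝ := fun x t => h⁻¹ * (R x (t + h) - R x t) with hDdef
  have hpos (t : ℝ) (ht : t ∈ Icc t₁ t₂) : 0 < t := h₁.trans_le ht.1
  have hne (x : ℝ) : u x ≠ 0 := (u₀_pos hφ hper x).ne'
  have hcu : Continuous fun q : ℝ × ℝ => u q.1 :=
    (contDiff_u₀ hφ hper).continuous.comp continuous_fst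
  have hsub : Icc (0 : ℝ) 1 ×ˢ Icc t₁ t₂ ⊆ Icc (-1) 2 ×ˢ Icc t₁ t₂ :=
    prod_mono_left fun x hx => mem_Icc_neg_one_two hx
  have hcV : ContinuousOn (Function.uncurry V) (Icc 0 1 ×ˢ Icc t₁ t₂) :=
    (hR.continuousOn_timeAverage hh h₁ h₁₂).mono hsub
  have hcD : ContinuousOn (Function.uncurry D) (Icc 0 1 ×ˢ Icc t₁ t₂) := by
    have hc := hR.continuousOn t₁ (t₂ + h) h₁ (by linarith)
    have e1 : ContinuousOn (fun q : ℝ × ℝ => R q.1 (q.2 + h)) (Icc 0 1 ×ˢ Icc t₁ t₂) :=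
      hc.comp (f := fun q : ℝ × ℝ => (q.1, q.2 + h)) (by fun_prop) fun q hq =>
        ⟨mem_Icc_neg_one_two hq.1, by linarith [hq.2.1], by linarith [hq.2.2]⟩
    have e2 : ContinuousOn (fun q : ℝ × ℝ => R q.1 q.2) (Icc 0 1 ×ˢ Icc t₁ t₂) :=
      hc.mono (prod_mono (fun x hx => mem_Icc_neg_one_two hx)
        (Icc_subset_Icc_right (by linarith)))
    exact (e1.sub e2).const_mul h⁻¹
  set A : ℝ → ℝ → ℝ := fun x t => (V x t - u x) ^ 2 / u x with hA
  set Q : ℝ → ℝ → ℝ := fun x t => (V x t - u x) / u x * D x t with hQ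
  have hcA : ContinuousOn (Function.uncurry A) (Icc 0 1 ×ˢ Icc t₁ t₂) :=
    ((hcV.sub hcu.continuousOn).pow 2).div hcu.continuousOn fun q _ => hne q.1
  have hcQ : ContinuousOn (Function.uncurry Q) (Icc 0 1 ×ˢ Icc t₁ t₂) :=
    ((hcV.sub hcu.continuousOn).div hcu.continuousOn fun q _ => hne q.1).mul hcD
  have hcexp : Continuous fun q : ℝ × ℝ => Real.exp (2 * m * q.2) := by fun_prop
  have hcF : ContinuousOn (Function.uncurry fun x t =>
      Real.exp (2 * m * t) * (2 * m * A x t + 2 * Q x t)) (Icc 0 1 ×ˢ Icc t₁ t₂) :=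
    hcexp.continuousOn.mul ((hcA.const_mul (2 * m)).add (hcQ.const_mul 2))
  have hswap := integral_swap_rect zero_le_one h₁₂ hcF
  have hinner (x : ℝ) (hx : x ∈ Icc (0 : ℝ) 1) :
      ∫ t in t₁..t₂, Real.exp (2 * m * t) * (2 * m * A x t + 2 * Q x t) =
        Real.exp (2 * m * t₂) * A x t₂ - Real.exp (2 * m * t₁) * A x t₁ := by
    refine intervalIntegral.integral_eq_sub_of_hasDerivAt
      (f := fun t => Real.exp (2 * m * t) * A x t) (fun t ht => ?_)
      ((hcF.rect_right hx).intervalIntegrable_Icc h₁₂)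
    rw [uIcc_of_le h₁₂] at ht
    have hVt := hR.hasDerivAt_timeAverage hh (mem_Icc_neg_one_two hx) (hpos t ht)
    have hexp : HasDerivAt (fun t => Real.exp (2 * m * t)) (2 * m * Real.exp (2 * m * t)) t := by
      refine ((hasDerivAt_id t).const_mul (2 * m)).exp.congr_deriv ?_
      simp only [id]; ring
    refine (hexp.mul (((hVt.sub_const (u x)).pow 2).div_const (u x))).congr_deriv ?_
    simp only [hA, hQ, hDdef, hVdef, Pi.pow_apply]
    norm_num
    ring
  have hAint (t : ℝ) (ht : t ∈ Icc t₁ t₂) : IntervalIntegrable (fun x => A x t) volume 0 1 :=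
    (hcA.rect_left ht).intervalIntegrable_Icc zero_le_one
  have hQint (t : ℝ) (ht : t ∈ Icc t₁ t₂) : IntervalIntegrable (fun x => Q x t) volume 0 1 :=
    (hcQ.rect_left ht).intervalIntegrable_Icc zero_le_one
  have hneg : ∫ t in t₁..t₂, ∫ x in (0 : ℝ)..1,
      Real.exp (2 * m * t) * (2 * m * A x t + 2 * Q x t) ≤ 0 := by
    rw [← neg_nonneg, ← intervalIntegral.integral_neg]
    refine intervalIntegral.integral_nonneg h₁₂ fun t ht => ?_
    rw [neg_nonneg, intervalIntegral.integral_const_mul, intervalIntegral.integral_add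
      ((hAint t ht).const_mul _) ((hQint t ht).const_mul _), intervalIntegral.integral_const_mul,
      intervalIntegral.integral_const_mul]
    have hs := hR.timeAverage_energy_slice hφ hper hh (hpos t ht) hm hmu
    refine mul_nonpos_of_nonneg_of_nonpos (Real.exp_pos _).le ?_
    have hs' : m * ∫ x in (0 : ℝ)..1, A x t ≤ -∫ x in (0 : ℝ)..1, Q x t := hs
    linarith
  have hm₁ : t₁ ∈ Icc t₁ t₂ := ⟨le_rfl, h₁₂⟩
  have hm₂ : t₂ ∈ Icc t₁ t₂ := ⟨h₁₂, le_rfl⟩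
  rw [← hswap, intervalIntegral.integral_congr (fun x hx => hinner x (by
      rwa [uIcc_of_le zero_le_one] at hx)), intervalIntegral.integral_sub
      ((hAint t₂ hm₂).const_mul _) ((hAint t₁ hm₁).const_mul _),
    intervalIntegral.integral_const_mul, intervalIntegral.integral_const_mul] at hneg
  linarith

lemma exists_bound (hR : PeriodicTimeIntegralSolution φ f R) {t₁ t₂ : ℝ} (h₁ : 0 < t₁)
    (h₁₂ : t₁ ≤ t₂) : ∃ K, ∀ x ∈ Icc (0 : ℝ) 1, ∀ t ∈ Icc t₁ t₂, |R x t| ≤ K := by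
  obtain ⟨K, hK⟩ := (isCompact_Icc.prod isCompact_Icc).exists_bound_of_continuousOn
    (hR.continuousOn t₁ t₂ h₁ h₁₂)
  exact ⟨K, fun x hx t ht => hK (x, t) ⟨mem_Icc_neg_one_two hx, ht⟩⟩

lemma abs_timeAverage_le {h x t K : ℝ} (hh : 0 < h) (hK : ∀ s ∈ Icc t (t + h), |R x s| ≤ K) :
    |timeAverage R h x t| ≤ K := by
  have hth : t ≤ t + h := by linarith
  have := intervalIntegral.norm_integral_le_of_norm_le_const (a := t) (b := t + h) (C := K)
    (f := R x) fun s hs => by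
      rw [uIoc_of_le hth] at hs
      exact hK s ⟨hs.1.le, hs.2⟩
  rw [add_sub_cancel_left, abs_of_pos hh, Real.norm_eq_abs] at this
  rw [timeAverage, abs_mul, abs_of_pos (inv_pos.2 hh), inv_mul_le_iff₀ hh, mul_comm]
  exact this

/-- The energy decay of time averages, with constants that do not depend on the length `h` of the
averaging interval, gives exponential decay in mean square as `h` tends to zero. -/
theorem exists_integral_sq_le (hφ : ContDiff ℝ 2 φ) (hper : Function.Periodic φ 1)
    (hR : PeriodicTimeIntegralSolution φ f R) :
    ∃ C μ : ℝ, 0 < μ ∧ ∀ t ≥ 1,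
      ∫ x in (0 : ℝ)..1, (R x t - u₀ φ f x) ^ 2 ≤ C * Real.exp (-(μ * t)) := by
  have hcu : Continuous (u₀ φ f) := (contDiff_u₀ hφ hper).continuous
  have hupos := u₀_pos (f := f) hφ hper
  obtain ⟨x₀, -, hx₀⟩ := isCompact_Icc.exists_isMinOn
    (⟨0, by simp⟩ : (Icc (0 : ℝ) 1).Nonempty) hcu.continuousOn
  obtain ⟨x₂, -, hx₂⟩ := isCompact_Icc.exists_isMaxOn
    (⟨0, by simp⟩ : (Icc (0 : ℝ) 1).Nonempty) hcu.continuousOn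
  set m := u₀ φ f x₀ with hm
  set U := u₀ φ f x₂ with hU
  have hmpos : 0 < m := hupos x₀
  have hUpos : 0 < U := hupos x₂
  have hmu (x : ℝ) (hx : x ∈ Icc (0 : ℝ) 1) : m ≤ u₀ φ f x := hx₀ hx
  have huU (x : ℝ) (hx : x ∈ Icc (0 : ℝ) 1) : u₀ φ f x ≤ U := hx₂ hx
  -- a bound for the energy density of time averages
  have hdens {h x t K : ℝ} (hh : 0 < h) (hx : x ∈ Icc (0 : ℝ) 1)
      (hK : ∀ s ∈ Icc t (t + h), |R x s| ≤ K) :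
      (timeAverage R h x t - u₀ φ f x) ^ 2 / u₀ φ f x ≤ (K + U) ^ 2 / m := by
    have h1 := abs_timeAverage_le hh hK
    have h2 : |timeAverage R h x t - u₀ φ f x| ≤ K + U := by
      refine (abs_sub _ _).trans (add_le_add h1 ?_)
      rw [abs_of_pos (hupos x)]
      exact huU x hx
    have h3 : (timeAverage R h x t - u₀ φ f x) ^ 2 ≤ (K + U) ^ 2 := by
      rw [← sq_abs]
      gcongr
    have h4 := hmu x hx
    gcongr
  obtain ⟨K₁, hK₁⟩ := hR.exists_bound one_pos (by norm_num : (1 : ℝ) ≤ 2)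
  refine ⟨U * ((K₁ + U) ^ 2 / m) * Real.exp (2 * m), 2 * m, by positivity, fun t ht => ?_⟩
  have ht0 : 0 < t := by linarith
  have hcont (h t : ℝ) (hh : 0 < h) (ht : 0 < t) : ContinuousOn
      (fun x => (timeAverage R h x t - u₀ φ f x) ^ 2 / u₀ φ f x) (Icc 0 1) := by
    have hcV := ((hR.continuousOn_timeAverage hh ht le_rfl).rect_left
      (⟨le_rfl, le_rfl⟩ : t ∈ Icc t t)).mono fun x hx => mem_Icc_neg_one_two hx
    exact ((hcV.sub hcu.continuousOn).pow 2).div hcu.continuousOn fun x _ => (hupos x).ne'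
  have haver (h : ℝ) (hh : h ∈ Ioc (0 : ℝ) 1) :
      ∫ x in (0 : ℝ)..1, (timeAverage R h x t - u₀ φ f x) ^ 2 / u₀ φ f x ≤
        (K₁ + U) ^ 2 / m * Real.exp (2 * m) * Real.exp (-(2 * m * t)) := by
    have h1 := hR.timeAverage_energy_le hφ hper hh.1 one_pos ht hmpos hmu
    have h2 : ∫ x in (0 : ℝ)..1, (timeAverage R h x 1 - u₀ φ f x) ^ 2 / u₀ φ f x ≤
        (K₁ + U) ^ 2 / m := by
      calc _ ≤ ∫ _ in (0 : ℝ)..1, (K₁ + U) ^ 2 / m :=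
            intervalIntegral.integral_mono_on zero_le_one
              ((hcont h 1 hh.1 one_pos).intervalIntegrable_Icc zero_le_one)
              intervalIntegrable_const fun x hx => hdens hh.1 hx fun s hs =>
                hK₁ x hx s ⟨hs.1, by linarith [hs.2, hh.2]⟩
        _ = _ := by rw [intervalIntegral.integral_const]; simp
    have h3 := h1.trans (mul_le_mul_of_nonneg_left h2 (Real.exp_pos (2 * m * 1)).le)
    rw [mul_one] at h3
    have h4 := mul_le_mul_of_nonneg_right h3 (Real.exp_pos (-(2 * m * t))).le
    have h5 : Real.exp (2 * m * t) * Real.exp (-(2 * m * t)) = 1 := by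
      rw [← Real.exp_add]; simp
    calc _ = (Real.exp (2 * m * t) * Real.exp (-(2 * m * t))) *
          ∫ x in (0 : ℝ)..1, (timeAverage R h x t - u₀ φ f x) ^ 2 / u₀ φ f x := by
            rw [h5, one_mul]
      _ ≤ _ := by linarith
  obtain ⟨K, hK⟩ := hR.exists_bound ht0 (show t ≤ t + 1 by linarith)
  have hI : ∀ x ∈ uIoc (0 : ℝ) 1, x ∈ Icc (0 : ℝ) 1 := fun x hx => by
    rw [uIoc_of_le zero_le_one] at hx; exact ⟨hx.1.le, hx.2⟩
  have hsmall : ∀ᶠ h in 𝓝[>] (0 : ℝ), h ∈ Ioc (0 : ℝ) 1 := Ioc_mem_nhdsGT zero_lt_one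
  have hlim : Tendsto (fun h => ∫ x in (0 : ℝ)..1,
      (timeAverage R h x t - u₀ φ f x) ^ 2 / u₀ φ f x) (𝓝[>] 0)
      (𝓝 (∫ x in (0 : ℝ)..1, (R x t - u₀ φ f x) ^ 2 / u₀ φ f x)) := by
    refine intervalIntegral.tendsto_integral_filter_of_dominated_convergence
      (fun _ => (K + U) ^ 2 / m) ?_ ?_ intervalIntegrable_const ?_
    · filter_upwards [hsmall] with h hh
      rw [uIoc_of_le zero_le_one]
      exact ((hcont h t hh.1 ht0).mono Ioc_subset_Icc_self).aestronglyMeasurable measurableSet_Ioc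
    · filter_upwards [hsmall] with h hh
      refine Eventually.of_forall fun x hx => ?_
      rw [Real.norm_of_nonneg (div_nonneg (sq_nonneg _) (hupos x).le)]
      exact hdens hh.1 (hI x hx) fun s hs => hK x (hI x hx) s ⟨hs.1, by linarith [hs.2, hh.2]⟩
    · refine Eventually.of_forall fun x hx => ?_
      exact (((hR.tendsto_timeAverage (mem_Icc_neg_one_two (hI x hx)) ht0).sub_const _).pow
        2).div_const _
  have hle := le_of_tendsto hlim (hsmall.mono haver)
  have hcR : ContinuousOn (fun x => R x t) (Icc 0 1) :=
    ((hR.continuousOn t t ht0 le_rfl).rect_left ⟨le_rfl, le_rfl⟩).mono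
      fun x hx => mem_Icc_neg_one_two hx
  have hc1 : ContinuousOn (fun x => (R x t - u₀ φ f x) ^ 2) (Icc 0 1) :=
    (hcR.sub hcu.continuousOn).pow 2
  have hc2 : ContinuousOn (fun x => (R x t - u₀ φ f x) ^ 2 / u₀ φ f x) (Icc 0 1) :=
    hc1.div hcu.continuousOn fun x _ => (hupos x).ne'
  calc ∫ x in (0 : ℝ)..1, (R x t - u₀ φ f x) ^ 2
      ≤ ∫ x in (0 : ℝ)..1, U * ((R x t - u₀ φ f x) ^ 2 / u₀ φ f x) := by
        refine intervalIntegral.integral_mono_on zero_le_one (hc1.intervalIntegrable_Icc zero_le_one)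
          ((hc2.const_mul U).intervalIntegrable_Icc zero_le_one) fun x hx => ?_
        have h1 := huU x hx
        have h2 := hupos x
        rw [← mul_div_assoc, le_div_iff₀ h2, mul_comm]
        gcongr
    _ ≤ U * ((K₁ + U) ^ 2 / m * Real.exp (2 * m) * Real.exp (-(2 * m * t))) := by
        rw [intervalIntegral.integral_const_mul]
        gcongr
    _ = _ := by ring

end PeriodicTimeIntegralSolution

end Decay

/-! ### Uniform convergence -/

section Convergence

variable {φ : ℝ → ℝ} {f : ℝ} {ρ : ℝ → ℝ → ℝ}

/-- Mean square decay becomes uniform decay: the mean value inequality for squares applies to the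
difference of `u₀` and a finite partial sum that is close enough to the periodized density. -/
lemma exists_sq_periodized_sub_le (hφ : ContDiff ℝ 2 φ) (hper : Function.Periodic φ 1)
    (hρ : FokkerPlanckDensity φ f ρ) :
    ∃ C μ : ℝ, 0 < μ ∧ ∀ t ≥ 2, ∀ x ∈ Icc (0 : ℝ) 1,
      (periodized ρ x t - u₀ φ f x) ^ 2 ≤ C * Real.exp (-(μ * t)) := by
  obtain ⟨B, hB, hb, hb'⟩ := exists_drift_bound hφ hper f
  have hR := hρ.periodized hφ hper
  obtain ⟨C, μ, hμ, hC⟩ := hR.exists_integral_sq_le hφ hper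
  have hcu : Continuous (u₀ φ f) := (contDiff_u₀ hφ hper).continuous
  set A := cylinderConst B 1 with hA
  have hA0 : 0 ≤ A := cylinderConst_nonneg B 1
  refine ⟨2 * A * (4 * C * Real.exp μ + 4) + 2, μ, hμ, fun t ht x hx => ?_⟩
  have ht1 : 0 < t - 1 := by linarith
  have htt : t - 1 ≤ t := by linarith
  obtain ⟨a, hsum, ha⟩ := exists_summable_bound hφ hper hρ ht1 htt
  -- the partial sums are uniformly close to the periodized density near the cylinder
  set ε : ℝ := Real.exp (-(μ * t) / 2) with hε
  have hε0 : 0 < ε := Real.exp_pos _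
  have hε2 : ε ^ 2 = Real.exp (-(μ * t)) := by
    rw [hε, ← Real.exp_nat_mul]; congr 1; push_cast; ring
  have hunif := tendstoUniformlyOn_tsum (f := fun (j : ℤ) (q : ℝ × ℝ) => ρ (j + q.1) q.2) hsum
    (s := Icc (-1) 2 ×ˢ Icc (t - 1) t) fun j q hq => norm_translate_le hρ ht1 ha j hq.1 hq.2
  obtain ⟨s, hs⟩ := (Metric.tendstoUniformlyOn_iff.1 hunif ε hε0).exists
  have hclose (y : ℝ) (hy : y ∈ Icc (-1 : ℝ) 2) (r : ℝ) (hr : r ∈ Icc (t - 1) t) :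
      (periodized ρ y r - ∑ j ∈ s, ρ (j + y) r) ^ 2 ≤ ε ^ 2 := by
    have h := hs (y, r) ⟨hy, hr⟩
    rw [Real.dist_eq] at h
    rw [← sq_abs]
    exact pow_le_pow_left₀ (abs_nonneg _) h.le 2
  have hsol := (IsSolution.sum s fun j : ℤ =>
    (hρ.solution.isSolution hφ).translate hper j).sub ((fokkerPlanck_u₀ hφ hper).isSolution hφ)
  have hmean := hsol.sq_le_integral hφ hB hb hb' (x₀ := x) (t₀ := t) one_pos le_rfl (by linarith)
  rw [← hA] at hmean
  have hsubx : Icc (x - 1) (x + 1) ⊆ Icc (-1 : ℝ) 2 :=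
    Icc_subset_Icc (by linarith [hx.1]) (by linarith [hx.2])
  have hxx : x - 1 ≤ x + 1 := by linarith
  have hcv : ContinuousOn (Function.uncurry fun y r => (∑ j ∈ s, ρ (j + y) r - u₀ φ f y) ^ 2)
      (Icc (x - 1) (x + 1) ×ˢ Icc (t - 1) t) :=
    (hsol.continuousOn.mono (prod_mono (subset_univ _) fun r hr => ht1.trans_le hr.1)).pow 2
  have hcR : ContinuousOn (Function.uncurry fun y r => (periodized ρ y r - u₀ φ f y) ^ 2)
      (Icc (-1) 2 ×ˢ Icc (t - 1) t) :=
    ((hR.continuousOn (t - 1) t ht1 htt).sub (hcu.comp continuous_fst).continuousOn).pow 2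
  have hslice (r : ℝ) (hr : r ∈ Icc (t - 1) t) :
      ∫ y in (x - 1)..(x + 1), (∑ j ∈ s, ρ (j + y) r - u₀ φ f y) ^ 2 ≤
        (4 * C * Real.exp μ + 4) * ε ^ 2 := by
    have hg : ContinuousOn (fun y => (periodized ρ y r - u₀ φ f y) ^ 2) (Icc (-1) 2) :=
      hcR.rect_left hr
    have hgint (p q : ℝ) (hpq : p ≤ q) (hp : -1 ≤ p) (hq : q ≤ 2) :
        IntervalIntegrable (fun y => (periodized ρ y r - u₀ φ f y) ^ 2) volume p q :=
      (hg.mono (Icc_subset_Icc hp hq)).intervalIntegrable_Icc hpq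
    have hgper : Function.Periodic (fun y => (periodized ρ y r - u₀ φ f y) ^ 2) 1 := fun y => by
      simp only [periodic_u₀ hper y]
      rw [show periodized ρ (y + 1) r = periodized ρ y r from hR.periodic r y]
    have hone (p : ℝ) : ∫ y in p..p + 1, (periodized ρ y r - u₀ φ f y) ^ 2 ≤
        C * Real.exp (-(μ * r)) := by
      rw [hgper.intervalIntegral_add_eq p 0, zero_add]
      exact hC r (by linarith [hr.1])
    have htwo : ∫ y in (x - 1)..(x + 1), (periodized ρ y r - u₀ φ f y) ^ 2 ≤
        2 * (C * Real.exp (-(μ * r))) := by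
      have h1 := hone (x - 1)
      rw [sub_add_cancel] at h1
      have h2 := hone x
      rw [← intervalIntegral.integral_add_adjacent_intervals
        (hgint (x - 1) x (by linarith) (by linarith [hx.1]) (by linarith [hx.2]))
        (hgint x (x + 1) (by linarith) (by linarith [hx.1]) (by linarith [hx.2]))]
      linarith
    have hC0 : 0 ≤ C := by
      have h1 := hC r (by linarith [hr.1])
      have h2 : 0 ≤ ∫ y in (0 : ℝ)..1, (periodized ρ y r - u₀ φ f y) ^ 2 :=
        intervalIntegral.integral_nonneg zero_le_one fun y _ => sq_nonneg _
      exact nonneg_of_mul_nonneg_left (h2.trans h1) (Real.exp_pos _)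
    have hexp : Real.exp (-(μ * r)) ≤ Real.exp μ * ε ^ 2 := by
      rw [hε2, ← Real.exp_add]
      refine Real.exp_le_exp.2 ?_
      have := mul_le_mul_of_nonneg_left hr.1 hμ.le
      linarith
    calc ∫ y in (x - 1)..(x + 1), (∑ j ∈ s, ρ (j + y) r - u₀ φ f y) ^ 2
        ≤ ∫ y in (x - 1)..(x + 1), (2 * (periodized ρ y r - u₀ φ f y) ^ 2 + 2 * ε ^ 2) := by
          refine intervalIntegral.integral_mono_on hxx
            ((hcv.rect_left hr).intervalIntegrable_Icc hxx)
            (((hgint _ _ hxx (by linarith [hx.1]) (by linarith [hx.2])).const_mul 2).add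
              intervalIntegrable_const) fun y hy => ?_
          have h1 := hclose y (hsubx hy) r hr
          have h2 := sq_nonneg ((periodized ρ y r - u₀ φ f y) +
            (periodized ρ y r - ∑ j ∈ s, ρ (j + y) r))
          linarith
      _ = 2 * (∫ y in (x - 1)..(x + 1), (periodized ρ y r - u₀ φ f y) ^ 2) + 4 * ε ^ 2 := by
          rw [intervalIntegral.integral_add
            ((hgint _ _ hxx (by linarith [hx.1]) (by linarith [hx.2])).const_mul 2)
            intervalIntegrable_const, intervalIntegral.integral_const_mul,
            intervalIntegral.integral_const, smul_eq_mul]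
          ring
      _ ≤ (4 * C * Real.exp μ + 4) * ε ^ 2 := by
          have := mul_le_mul_of_nonneg_left hexp hC0
          linarith
  have hcyl : ∫ r in (t - 1)..t, ∫ y in (x - 1)..(x + 1),
      (∑ j ∈ s, ρ (j + y) r - u₀ φ f y) ^ 2 ≤ (4 * C * Real.exp μ + 4) * ε ^ 2 := by
    calc _ ≤ ∫ _ in (t - 1)..t, (4 * C * Real.exp μ + 4) * ε ^ 2 :=
          intervalIntegral.integral_mono_on htt
            ((continuousOn_integral_rect hxx htt hcv).intervalIntegrable_Icc htt)
            intervalIntegrable_const hslice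
      _ = _ := by rw [intervalIntegral.integral_const]; simp
  have h1 := hmean.trans (mul_le_mul_of_nonneg_left hcyl hA0)
  have h2 := hclose x (mem_Icc_neg_one_two hx) t ⟨htt, le_rfl⟩
  have h3 := sq_nonneg ((∑ j ∈ s, ρ (j + x) t - u₀ φ f x) -
    (periodized ρ x t - ∑ j ∈ s, ρ (j + x) t))
  rw [← hε2]
  linarith

lemma tendstoUniformly_periodized (hφ : ContDiff ℝ 2 φ) (hper : Function.Periodic φ 1)
    (hρ : FokkerPlanckDensity φ f ρ) :
    TendstoUniformly (fun t x => periodized ρ x t) (u₀ φ f) atTop := by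
  obtain ⟨C, μ, hμ, hC⟩ := exists_sq_periodized_sub_le hφ hper hρ
  rw [Metric.tendstoUniformly_iff]
  intro ε hε
  have hlim : Tendsto (fun t => C * Real.exp (-(μ * t))) atTop (𝓝 (C * 0)) :=
    (Real.tendsto_exp_neg_atTop_nhds_zero.comp (tendsto_id.const_mul_atTop hμ)).const_mul C
  rw [mul_zero] at hlim
  filter_upwards [hlim.eventually (gt_mem_nhds (show 0 < ε ^ 2 by positivity)),
    eventually_ge_atTop 2] with t ht ht2 x
  obtain ⟨y, hy, hxy⟩ := ((periodic_u₀ (f := f) hper).sub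
    (periodic_periodized ρ t)).exists_mem_Ico zero_lt_one x 0
  rw [zero_add] at hy
  simp only [Pi.sub_apply] at hxy
  rw [Real.dist_eq, hxy, abs_sub_comm]
  exact abs_lt_of_sq_lt_sq ((hC t ht2 y ⟨hy.1, hy.2.le⟩).trans_lt ht) hε.le

end Convergence

theorem mainTheorem2 (φ : ℝ → ℝ) (f : ℝ) (hφ : ContDiff ℝ 2 φ) (hper : Function.Periodic φ 1) :
    -- `u₀` is a normalized periodic steady state, and the only one
    (SteadyState φ f (u₀ φ f) ∧ ∀ u : ℝ → ℝ, SteadyState φ f u → u = u₀ φ f) ∧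
    -- its flux is the constant `J₀`
    (0 < M₀ φ f ∧ ∀ x, flux φ f (u₀ φ f) x = (1 - Real.exp (-f)) / M₀ φ f) ∧
    -- the series for `ρ₀` converges, and `ρ₀` tends to `u₀`, uniformly in `x`
    (∀ ρ : ℝ → ℝ → ℝ, FokkerPlanckDensity φ f ρ →
      (∀ x, ∀ t > 0, Summable fun j : ℤ => ρ ((j : ℝ) + x) t) ∧
      TendstoUniformly (fun t x => periodized ρ x t) (u₀ φ f) atTop) :=
  ⟨⟨steadyState_u₀ hφ hper, fun _ hu => hu.eq_u₀ hφ hper⟩,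
    ⟨M₀_pos hφ hper, flux_u₀ hφ hper⟩,
    fun _ hρ => ⟨fun x _ ht => summable_translates hφ hper hρ x ht,
      tendstoUniformly_periodized hφ hper hρ⟩⟩
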